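/- Let $r\ge 1$, $\Omega=(a,b)$ with $a<b$, and $\alpha_0,\kappa>0$. There is a constant $c_2>0$, depending only on $r,\alpha_0,\kappa,\Omega$, and for every $\Lambda$ there are constants $M>0$ and $h_0>0$, depending only on $r,\alpha_0,\kappa,\Omega,\Lambda$, such that the following holds for all coefficients $\alpha,\beta,\gamma\in L^\infty(\Omega)$ with $L^\infty$-norms at most $\Lambda$, $\beta$ having a weak derivative $\beta'\in L^1(\Omega)$, and $\alpha\ge\alpha_0$, $\gamma-\tfrac12\beta'\ge\kappa$ almost everywhere in $\Omega$. Setting. Let $\mathcal P$ be a partition $a=x_0<x_1<\dots<x_N=b$, $N\ge1$, with $\tau_i=[x_{i-1},x_i]$, $h_i=x_i-x_{i-1}$, $h=\max_i h_i$. Let $G_1<\dots<G_r$ be the zeros of the Legendre polynomial of degree $r$, $g_{i,j}=\tfrac12(x_i+x_{i-1}+h_iG_j)$ for $1\le i\le N$, $1\le j\le r$, and $g_{i,r+1}=g_{i+1,1}$ for $i<N$. Assume that $\alpha$ is continuous at all points $g_{i,j}$, so that its values there are defined. Let $r_i=r$ for $i<N$ and $r_N=r-1$. The trial space $U^r_{\mathcal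 P}$ consists of the continuous functions on $[a,b]$ that are polynomials of degree at most $r$ on each $\tau_i$ and vanish at $a$ and $b$. The test space $V_{\mathcal P'}$ consists of the functions $w=\sum_{i=1}^N\sum_{j=1}^{r_i}w_{i,j}\chi_{[g_{i,j},g_{i,j+1}]}$ with real coefficients; set $w_{1,0}=w_{N,r}=0$, $w_{i,0}=w_{i-1,r}$ for $2\le i\le N$, and $[w_{i,j}]=w_{i,j}-w_{i,j-1}$. Let $H^2_{\mathcal P}$ be the space of continuous functions on $[a,b]$ whose restriction to each $\tau_i$ is in $H^2(\tau_i)$. Define $$a_{\mathcal P}(v,w)=\sum_{i=1}^N\sum_{j=1}^r[w_{i,j}]\,\alpha(g_{i,j})v'(g_{i,j})+\sum_{i=1}^N\sum_{j=1}^{r_i}w_{i,j}\int_{g_{i,j}}^{g_{i,j+1}}(\beta v'+\gamma v)\,dx,$$ $$\|v\|_{\mathcal P}^2=\sum_{i=1}^N\Big(\|v\|_{L^2(\tau_i)}^2+\|v'\|_{L^2(\tau_i)}^2+h_i^2\|v''\|_{L^2(\tau_i)}^2\Big),\qquad \|w\|_{\mathcal P'}^2=\sum_{i=1}^N\sum_{j=1}^r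 h_i^{-1}[w_{i,j}]^2+\sum_{i=1}^N\sum_{j=1}^{r_i}h_iw_{i,j}^2 .$$ For $f\in L^1(\Omega)$ let $(f,w)=\int_a^b fw\,dx$. A solution $u$ of the boundary value problem is a function $u\in H^1_0(\Omega)$ with $-(\alpha u')'+\beta u'+\gamma u=f$ weakly in $\Omega$; a finite volume solution is a function $u_{\mathcal P}\in U^r_{\mathcal P}$ with $a_{\mathcal P}(u_{\mathcal P},w)=(f,w)$ for all $w\in V_{\mathcal P'}$. Claim. (1) (Variational exactness) If $u$ is a solution of the boundary value problem with right-hand side $f\in L^1(\Omega)$, then $a_{\mathcal P}(u,w)=(f,w)$ for all $w\in V_{\mathcal P'}$. (2) (Boundedness) $|a_{\mathcal P}(v,w)|\le M\|v\|_{\mathcal P}\|w\|_{\mathcal P'}$ for all $v\in H^1_0(\Omega)\cap H^2_{\mathcal P}$ and $w\in V_{\mathcal P'}$. (3) (Quasi-optimality) If $h\le h_0$, then the inf-sup condition $\sup_{0\ne w\in V_{\mathcal P'}}\frac{a_{\mathcal P}(v,w)}{\|w\|_{\mathcal P'}}\ge c_2\|v\|_{\mathcal P}$ holds for all $v\in U^r_{\mathcal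 P}$ (with the supremum read as $0$ if $V_{\mathcal P'}=\{0\}$), and whenever $u\in H^2_{\mathcal P}$ is a solution of the boundary value problem with right-hand side $f\in L^1(\Omega)$ and $u_{\mathcal P}$ is a finite volume solution for the same $f$, $$\|u-u_{\mathcal P}\|_{\mathcal P}\le\frac{M}{c_2}\inf_{v\in U^r_{\mathcal P}}\|u-v\|_{\mathcal P}.$$ -/

import Mathlib

open MeasureTheory Set Finset Polynomial
open scoped ContDiff

noncomputable section

namespace FVM

/-! ### Sobolev spaces on an interval -/

/-- `g` is the weak derivative of `v` on the open interval `(c, d)`: both functions are locally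
integrable there and `∫ v φ' = - ∫ g φ` for every smooth `φ` with compact support in `(c, d)`. -/
structure HasWeakDeriv (c d : ℝ) (v g : ℝ → ℝ) : Prop where
  locInt : LocallyIntegrableOn v (Set.Ioo c d)
  locInt_deriv : LocallyIntegrableOn g (Set.Ioo c d)
  integral_eq : ∀ φ : ℝ → ℝ, ContDiff ℝ ∞ φ → HasCompactSupport φ → tsupport φ ⊆ Set.Ioo c d →
    ∫ x in Set.Ioo c d, v x * deriv φ x = - ∫ x in Set.Ioo c d, g x * φ x

/-- `v ∈ H¹(c, d)`: `v` and its weak derivative are square integrable. It is used only for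
representatives `v` that are continuous on `(c, d)`; these are absolutely continuous as soon as a
weak derivative in `L²` exists, their classical derivative exists almost everywhere and is that
weak derivative. Therefore the weak derivative is written `deriv v` from the start. -/
structure MemH1 (c d : ℝ) (v : ℝ → ℝ) : Prop where
  memLp : MemLp v 2 (volume.restrict (Set.Ioo c d))
  memLp_deriv : MemLp (deriv v) 2 (volume.restrict (Set.Ioo c d))
  weakDeriv : HasWeakDeriv c d v (deriv v)

/-- `v ∈ H²(c, d)`: `v` and its weak derivative belong to `H¹(c, d)`. A continuous such `v` is
continuously differentiable in `(c, d)`, so `deriv v` is its classical derivative everywhere in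
`(c, d)`. -/
structure MemH2 (c d : ℝ) (v : ℝ → ℝ) : Prop where
  memH1 : MemH1 c d v
  memH1_deriv : MemH1 c d (deriv v)

/-- `v ∈ H¹₀(a, b)`, given by its continuous representative on `[a, b]`. -/
structure MemH10 (a b : ℝ) (v : ℝ → ℝ) : Prop where
  cont : ContinuousOn v (Set.Icc a b)
  memH1 : MemH1 a b v
  left : v a = 0
  right : v b = 0

/-! ### The boundary value problem -/

/-- The standing assumptions on the coefficients of `-(α u')' + β u' + γ u = f` on `(a, b)`:
`α, β, γ ∈ L^∞` with norms at most `Λ`, `α ≥ α₀`, and `γ - β' / 2 ≥ κ` where `β'` is the weak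
derivative of `β` (an integrable function). -/
structure Admissible (a b α₀ κ Λ : ℝ) (α β γ : ℝ → ℝ) : Prop where
  meas_α : AEStronglyMeasurable α (volume.restrict (Set.Ioo a b))
  meas_β : AEStronglyMeasurable β (volume.restrict (Set.Ioo a b))
  meas_γ : AEStronglyMeasurable γ (volume.restrict (Set.Ioo a b))
  bound_α : ∀ᵐ x ∂(volume.restrict (Set.Ioo a b)), |α x| ≤ Λ
  bound_β : ∀ᵐ x ∂(volume.restrict (Set.Ioo a b)), |β x| ≤ Λ
  bound_γ : ∀ᵐ x ∂(volume.restrict (Set.Ioo a b)), |γ x| ≤ Λ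
  lower_α : ∀ᵐ x ∂(volume.restrict (Set.Ioo a b)), α₀ ≤ α x
  lower_γ : ∃ β' : ℝ → ℝ, IntegrableOn β' (Set.Ioo a b) ∧ HasWeakDeriv a b β β' ∧
    ∀ᵐ x ∂(volume.restrict (Set.Ioo a b)), κ ≤ γ x - β' x / 2

/-- `u` is the (weak) solution of `-(α u')' + β u' + γ u = f` in `(a, b)`, `u(a) = u(b) = 0`:
`u ∈ H¹₀(a, b)` and `(α u')' = β u' + γ u - f` in the weak sense. -/
structure IsSolution (a b : ℝ) (α β γ f u : ℝ → ℝ) : Prop where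
  memH10 : MemH10 a b u
  eqn : HasWeakDeriv a b (fun x => α x * deriv u x)
    (fun x => β x * deriv u x + γ x * u x - f x)

/-! ### Gauss points -/

/-- The Legendre polynomial of degree `r` (Rodrigues' formula). -/
def legendre (r : ℕ) : ℝ[X] :=
  C (1 / (2 ^ r * (r.factorial : ℝ))) * derivative^[r] ((X ^ 2 - 1) ^ r)

/-- The Gauss points `G_1 < ⋯ < G_r`: the zeros of the Legendre polynomial of degree `r` in
increasing order (the value is irrelevant unless `1 ≤ j ≤ r`). -/
def gaussPoint (r j : ℕ) : ℝ :=
  ((legendre r).roots.toFinset.sort (· ≤ ·)).getD (j - 1) 0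

/-! ### Primal partition, trial space and norms -/

/-- A partition `a = x_0 < x_1 < ⋯ < x_N = b` with `N ≥ 1` (values `x i`, `i > N`, play no role). -/
structure Partition (a b : ℝ) where
  N : ℕ
  one_le_N : 1 ≤ N
  x : ℕ → ℝ
  x_zero : x 0 = a
  x_N : x N = b
  lt : ∀ i ∈ Finset.Icc 1 N, x (i - 1) < x i

variable {a b : ℝ}

/-- The length `h_i` of the element `τ_i = [x_{i-1}, x_i]`. -/
def Partition.h (P : Partition a b) (i : ℕ) : ℝ := P.x i - P.x (i - 1)

/-- The trial space `U^r_P`: continuous functions on `[a, b]` that are polynomials of degree at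
most `r` on every element and vanish at `a` and `b`. -/
def trialSpace (P : Partition a b) (r : ℕ) : Set (ℝ → ℝ) :=
  {v | ContinuousOn v (Set.Icc a b) ∧
    (∀ i ∈ Finset.Icc 1 P.N, ∃ p : ℝ[X], p.natDegree ≤ r ∧
      ∀ x ∈ Set.Icc (P.x (i - 1)) (P.x i), v x = p.eval x) ∧
    v a = 0 ∧ v b = 0}

/-- `v` belongs to the broken space `H²_P`: continuous, and in `H²` of every element. -/
def MemBrokenH2 (P : Partition a b) (v : ℝ → ℝ) : Prop :=
  ContinuousOn v (Set.Icc a b) ∧ ∀ i ∈ Finset.Icc 1 P.N, MemH2 (P.x (i - 1)) (P.x i) v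

/-- `‖v‖_P = (∑_i ‖v‖²_{0,τ_i} + |v|²_{1,τ_i} + h_i² |v|²_{2,τ_i})^{1/2}`. -/
def normP (P : Partition a b) (v : ℝ → ℝ) : ℝ :=
  Real.sqrt (∑ i ∈ Finset.Icc 1 P.N,
    ((∫ x in Set.Ioo (P.x (i - 1)) (P.x i), v x ^ 2)
      + (∫ x in Set.Ioo (P.x (i - 1)) (P.x i), deriv v x ^ 2)
      + P.h i ^ 2 * ∫ x in Set.Ioo (P.x (i - 1)) (P.x i), deriv (deriv v) x ^ 2))

/-! ### Dual partition and test space -/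

/-- The Gauss point `g_{i,j}` of `τ_i` for `1 ≤ j ≤ r`, with `g_{i,r+1} = g_{i+1,1}`. -/
def gpt (P : Partition a b) (r i j : ℕ) : ℝ :=
  if j = r + 1 then (P.x (i + 1) + P.x i + P.h (i + 1) * gaussPoint r 1) / 2
  else (P.x i + P.x (i - 1) + P.h i * gaussPoint r j) / 2

/-- `r_i = r` for `i < N` and `r_N = r - 1`. -/
def rIdx (P : Partition a b) (r i : ℕ) : ℕ := if i = P.N then r - 1 else r

/-- The test function `∑_{i ≤ N} ∑_{j ≤ r_i} w_{i,j} ψ_{i,j}`, where `ψ_{i,j}` is the characteristic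
function of `[g_{i,j}, g_{i,j+1}]`. The test space consists of these functions; an element is given
by its coefficients `w i j`, and only those with `1 ≤ i ≤ N`, `1 ≤ j ≤ r_i` matter. -/
def testFun (P : Partition a b) (r : ℕ) (w : ℕ → ℕ → ℝ) (x : ℝ) : ℝ :=
  ∑ i ∈ Finset.Icc 1 P.N, ∑ j ∈ Finset.Icc 1 (rIdx P r i),
    w i j * (Set.Icc (gpt P r i j) (gpt P r i (j + 1))).indicator (fun _ => (1 : ℝ)) x

/-- The coefficients extended by `w_{1,0} = w_{N,r} = 0` and `w_{i,0} = w_{i-1,r}`, `2 ≤ i`. -/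
def extCoef (P : Partition a b) (r : ℕ) (w : ℕ → ℕ → ℝ) (i j : ℕ) : ℝ :=
  if (i = 1 ∧ j = 0) ∨ (i = P.N ∧ j = r) then 0
  else if j = 0 then w (i - 1) r
  else w i j

/-- The jump `[w_{i,j}] = w_{i,j} - w_{i,j-1}` at the Gauss point `g_{i,j}`. -/
def jump (P : Partition a b) (r : ℕ) (w : ℕ → ℕ → ℝ) (i j : ℕ) : ℝ :=
  extCoef P r w i j - extCoef P r w i (j - 1)

/-- The norm `‖w‖_{P'}`, with
`‖w‖²_{P'} = ∑_i ∑_{j ≤ r} h_i⁻¹ [w_{i,j}]² + ∑_i ∑_{j ≤ r_i} h_i w_{i,j}²`. -/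
def normP' (P : Partition a b) (r : ℕ) (w : ℕ → ℕ → ℝ) : ℝ :=
  Real.sqrt ((∑ i ∈ Finset.Icc 1 P.N, ∑ j ∈ Finset.Icc 1 r, (P.h i)⁻¹ * jump P r w i j ^ 2)
    + ∑ i ∈ Finset.Icc 1 P.N, ∑ j ∈ Finset.Icc 1 (rIdx P r i), P.h i * w i j ^ 2)

/-! ### The finite volume method -/

/-- The finite volume bilinear form `a_P(v, w)`. -/
def aP (α β γ : ℝ → ℝ) (P : Partition a b) (r : ℕ) (v : ℝ → ℝ) (w : ℕ → ℕ → ℝ) : ℝ :=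
  (∑ i ∈ Finset.Icc 1 P.N, ∑ j ∈ Finset.Icc 1 r,
      jump P r w i j * α (gpt P r i j) * deriv v (gpt P r i j))
    + ∑ i ∈ Finset.Icc 1 P.N, ∑ j ∈ Finset.Icc 1 (rIdx P r i),
      w i j * ∫ x in (gpt P r i j)..(gpt P r i (j + 1)), (β x * deriv v x + γ x * v x)

/-- The pairing `(f, w) = ∫_a^b f w` with a test function. -/
def pairing (f : ℝ → ℝ) (P : Partition a b) (r : ℕ) (w : ℕ → ℕ → ℝ) : ℝ :=
  ∫ x in a..b, f x * testFun P r w x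

/-- `uP` solves the finite volume scheme: `uP ∈ U^r_P` and `a_P(uP, w) = (f, w)` for all test
functions `w`. -/
def IsFVMSolution (α β γ f : ℝ → ℝ) (P : Partition a b) (r : ℕ) (uP : ℝ → ℝ) : Prop :=
  uP ∈ trialSpace P r ∧ ∀ w : ℕ → ℕ → ℝ, aP α β γ P r uP w = pairing f P r w

/-- The inf-sup condition with constant `c`:
`sup_w a_P(v, w) / ‖w‖_{P'} ≥ c ‖v‖_P` for every `v ∈ U^r_P` (`0 / 0 = 0` for `w = 0`). -/
def InfSup (α β γ : ℝ → ℝ) (P : Partition a b) (r : ℕ) (c : ℝ) : Prop :=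
  ∀ v ∈ trialSpace P r,
    c * normP P v ≤ ⨆ w : ℕ → ℕ → ℝ, aP α β γ P r v w / normP' P r w

end FVM

end

/-! The argument rests on Gauss quadrature with `r` points, which is exact up to degree `2r - 1`.
For a trial function `v`, take the test function whose jump at `g_{i,j}` is the quadrature weight
times `v'(g_{i,j})` (`dualCoef`). Exactness for `v'` makes the jumps on `τ_i` add up to `v(x_i) -
v(x_{i-1})`. The coefficients therefore fit together across elements and vanish at both ends
(`extCoef_dualCoef`). Exactness for `(v')²`, of degree at most `2r - 2`, turns the diffusion part
into a weighted sum that is at least `α₀ ∫ (v')²`.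

On `τ_i` the coefficients differ from `v` by at most a multiple of `h_i^{1/2} ‖v'‖`. Replacing them
by `v` in the lower order terms thus costs `O(Λ h)` times the squared `H¹` norm. What remains, `∫ v
(β v' + γ v)`, is bounded below by `κ ∫ v²` after integrating `β (v²)'/2` by parts. For small `h`
this gives coercivity with constant `min α₀ κ / 2` (`Admissible.mul_sum_h1Sq_le`). The dual norm of
the test function is bounded by the `H¹` norm of `v`, and the inverse inequality absorbs the `h_i²
‖v''‖²` terms, so the inf-sup condition follows. `Λ` restricts only the mesh size and does not enter
the inf-sup constant.

Variational exactness: the flux `α u'` has an integrable weak derivative, hence an absolutely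
continuous representative (`HasWeakDeriv.exists_ae_eq`). Where `α` is continuous, this
representative equals `α` times the classical derivative of `u` (`IsSolution.exists_flux`).
Integrating the equation over the pieces of control volumes and summing by parts gives the scheme.
Boundedness is a weighted Cauchy-Schwarz inequality combined with a bound for point values of `v'`
by the local energy.

Quasi-optimality with factor `M / c₂` instead of `1 + M / c₂` uses that `normP` comes from an inner
product: the argument of Xu and Zikatanov compares the error `q` and `p = u_P - v` through rescaled
combinations `s q + t p` (`le_mul_of_forall_projection_le`). -/

namespace FVM

/-! ### Functions with an integrable weak derivative are absolutely continuous -/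

/-- Integration by parts for a primitive and a continuously differentiable function. -/
theorem integral_primitive_mul_deriv {c d : ℝ} {g φ : ℝ → ℝ} (C : ℝ)
    (hg : IntervalIntegrable g volume c d) (hφ : ContDiff ℝ 1 φ) :
    ∫ x in c..d, (C + ∫ t in c..x, g t) * deriv φ x
      = (C + ∫ t in c..d, g t) * φ d - C * φ c - ∫ x in c..d, g x * φ x := by
  have hac : AbsolutelyContinuousOnInterval (fun x => C + ∫ t in c..x, g t) c d :=
    (LipschitzOnWith.absolutelyContinuousOnInterval
      (LipschitzWith.const C).lipschitzOnWith).add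
      (hg.absolutelyContinuousOnInterval_intervalIntegral (c := c) (by simp))
  rw [hac.integral_mul_deriv_eq_deriv_mul hφ.contDiffOn.absolutelyContinuousOnInterval]
  simp only [intervalIntegral.integral_same, add_zero]
  congr 1
  apply intervalIntegral.integral_congr_ae
  filter_upwards [hg.ae_hasDerivAt_integral] with x hx hx'
  rw [((hx (uIoc_subset_uIcc hx') c (by simp)).const_add C).deriv]

theorem setIntegral_Ioo_eq {c d : ℝ} (hcd : c ≤ d) (f : ℝ → ℝ) :
    ∫ x in Set.Ioo c d, f x = ∫ x in c..d, f x := by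
  rw [intervalIntegral.integral_of_le hcd, integral_Ioc_eq_integral_Ioo]

theorem intervalIntegrable_of_Ioo {c d : ℝ} (hcd : c ≤ d) {f : ℝ → ℝ}
    (hf : IntegrableOn f (Set.Ioo c d)) : IntervalIntegrable f volume c d :=
  (intervalIntegrable_iff_integrableOn_Ioo_of_le hcd).2 hf

theorem IntervalIntegrable.continuousOn_primitive {c d : ℝ} (hcd : c ≤ d) {g : ℝ → ℝ}
    (hg : IntervalIntegrable g volume c d) (C : ℝ) :
    ContinuousOn (fun x => C + ∫ t in c..x, g t) (Set.Icc c d) := by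
  have := intervalIntegral.continuousOn_primitive_interval' hg (a := c) (by simp)
  rw [uIcc_of_le hcd] at this
  exact continuousOn_const.add this

/-- A smooth function whose integral vanishes and whose support is compact in `(c, d)` is the
derivative of a function of the same kind. -/
theorem exists_testFunction_deriv_eq {c d : ℝ} (hcd : c < d) {χ : ℝ → ℝ} (hχ : ContDiff ℝ ∞ χ)
    (hc : HasCompactSupport χ) (hs : tsupport χ ⊆ Set.Ioo c d) (h0 : ∫ x in c..d, χ x = 0) :
    ∃ φ : ℝ → ℝ, ContDiff ℝ ∞ φ ∧ HasCompactSupport φ ∧ tsupport φ ⊆ Set.Ioo c d ∧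
      deriv φ = χ := by
  have hder : ∀ x, HasDerivAt (fun y => ∫ t in c..y, χ t) (χ x) x := fun x =>
    intervalIntegral.integral_hasDerivAt_right (hχ.continuous.intervalIntegrable _ _)
      (hχ.continuous.stronglyMeasurableAtFilter _ _) hχ.continuous.continuousAt
  have hderiv : deriv (fun y => ∫ t in c..y, χ t) = χ := funext fun x => (hder x).deriv
  obtain ⟨c', d', hc', hd', hsub⟩ : ∃ c' d', c < c' ∧ d' < d ∧ tsupport χ ⊆ Set.Icc c' d' := by
    rcases (tsupport χ).eq_empty_or_nonempty with he | hne
    -- For empty support the reversed interval `[d, c]` is empty and satisfies both strict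
    -- inequalities.
    · exact ⟨d, c, hcd, hcd, by simp [he]⟩
    · have hcomp : IsCompact (tsupport χ) := hc
      exact ⟨sInf (tsupport χ), sSup (tsupport χ), (hs (hcomp.sInf_mem hne)).1,
        (hs (hcomp.sSup_mem hne)).2, fun x hx => ⟨csInf_le hcomp.bddBelow hx,
          le_csSup hcomp.bddAbove hx⟩⟩
  have hzero : ∀ x, x ∉ Set.Icc c' d' → χ x = 0 := fun x hx =>
    image_eq_zero_of_notMem_tsupport fun h => hx (hsub h)
  -- Left of `c'` nothing has been integrated yet; right of `d'` the whole mass of `χ` has been, and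
  -- it is zero.
  have hsupp : tsupport (fun y => ∫ t in c..y, χ t) ⊆ Set.Icc c' d' := by
    refine closure_minimal (fun x hx => ?_) isClosed_Icc
    by_contra hxc
    apply hx
    rw [Set.mem_Icc, not_and_or, not_le, not_le] at hxc
    show ∫ t in c..x, χ t = 0
    rcases hxc with h | h
    · refine intervalIntegral.integral_zero_ae (Filter.Eventually.of_forall fun t ht => hzero t ?_)
      have := ht.2
      intro h'
      have := h'.1
      have : t ≤ max c x := ht.2
      have := max_lt hc' h
      linarith
    · have : ∫ t in x..d, χ t = 0 := by
        refine intervalIntegral.integral_zero_ae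
          (Filter.Eventually.of_forall fun t ht => hzero t fun h' => ?_)
        have h1 : min x d < t := ht.1
        have := lt_min h hd'
        have := h'.2
        linarith
      rw [← intervalIntegral.integral_add_adjacent_intervals (b := x) (c := d)
        (hχ.continuous.intervalIntegrable _ _) (hχ.continuous.intervalIntegrable _ _), this,
        add_zero] at h0
      exact h0
  refine ⟨fun y => ∫ t in c..y, χ t, ?_, ?_, hsupp.trans fun x hx =>
    ⟨hc'.trans_le hx.1, hx.2.trans_lt hd'⟩, hderiv⟩
  · rw [contDiff_infty_iff_deriv, hderiv]
    exact ⟨fun x => (hder x).differentiableAt, hχ⟩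
  · exact HasCompactSupport.of_support_subset_isCompact isCompact_Icc
      ((subset_tsupport _).trans hsupp)

theorem exists_testFunction_integral_eq_one {c d : ℝ} (hcd : c < d) :
    ∃ η : ℝ → ℝ, ContDiff ℝ ∞ η ∧ HasCompactSupport η ∧ tsupport η ⊆ Set.Ioo c d ∧
      ∫ x in c..d, η x = 1 := by
  let B : ContDiffBump ((c + d) / 2) := ⟨(d - c) / 8, (d - c) / 4, by linarith, by linarith⟩
  have hsub : tsupport (B.normed volume) ⊆ Set.Ioo c d := by
    rw [B.tsupport_normed_eq, Real.closedBall_eq_Icc]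
    intro x hx
    have h1 : (c + d) / 2 - (d - c) / 4 ≤ x := hx.1
    have h2 : x ≤ (c + d) / 2 + (d - c) / 4 := hx.2
    constructor <;> linarith
  refine ⟨B.normed volume, B.contDiff_normed, B.hasCompactSupport_normed, hsub, ?_⟩
  rw [← setIntegral_Ioo_eq hcd.le, setIntegral_eq_integral_of_forall_compl_eq_zero,
    B.integral_normed]
  exact fun x hx => image_eq_zero_of_notMem_tsupport fun h => hx (hsub h)

/-- The lemma of du Bois-Reymond: a function with an integrable weak derivative `g` coincides
almost everywhere with a primitive of `g`. -/
theorem HasWeakDeriv.exists_ae_eq {c d : ℝ} (hcd : c < d) {v g : ℝ → ℝ}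
    (h : HasWeakDeriv c d v g) (hv : IntegrableOn v (Set.Ioo c d))
    (hg : IntegrableOn g (Set.Ioo c d)) :
    ∃ C : ℝ, ∀ᵐ x, x ∈ Set.Ioo c d → v x = C + ∫ t in c..x, g t := by
  have hvi := intervalIntegrable_of_Ioo hcd.le hv
  have hgi := intervalIntegrable_of_Ioo hcd.le hg
  have hWc : ContinuousOn (fun x => ∫ t in c..x, g t) (Set.uIcc c d) := by
    rw [uIcc_of_le hcd.le]
    simpa using IntervalIntegrable.continuousOn_primitive hcd.le hgi 0
  have hui : IntervalIntegrable (fun x => v x - ∫ t in c..x, g t) volume c d :=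
    hvi.sub hWc.intervalIntegrable
  have key : ∀ φ : ℝ → ℝ, ContDiff ℝ ∞ φ → HasCompactSupport φ → tsupport φ ⊆ Set.Ioo c d →
      ∫ x in c..d, (v x - ∫ t in c..x, g t) * deriv φ x = 0 := by
    intro φ hφ hφc hφs
    have h1 := h.integral_eq φ hφ hφc hφs
    rw [setIntegral_Ioo_eq hcd.le, setIntegral_Ioo_eq hcd.le] at h1
    have h2 := integral_primitive_mul_deriv 0 hgi (hφ.of_le (by exact_mod_cast le_top))
    have hφd : φ d = 0 := image_eq_zero_of_notMem_tsupport fun h => lt_irrefl _ (hφs h).2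
    rw [hφd] at h2
    simp only [zero_add, mul_zero, zero_mul, sub_zero, zero_sub] at h2
    have hdc : Continuous (deriv φ) := hφ.continuous_deriv (by simp)
    have hWi : IntervalIntegrable (fun x => (∫ t in c..x, g t) * deriv φ x) volume c d :=
      (hWc.mul hdc.continuousOn).intervalIntegrable
    simp only [sub_mul]
    rw [intervalIntegral.integral_sub (hvi.mul_continuousOn hdc.continuousOn) hWi, h1, h2,
      sub_self]
  -- Since `η` has mass one, any test function `ψ` minus its mass times `η` is the derivative of a
  -- test function. Then `key` says that `u - C` is orthogonal to every `ψ`, where `C = ∫ u η`.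
  obtain ⟨η, hη, hηc, hηs, hη1⟩ := exists_testFunction_integral_eq_one hcd
  set u : ℝ → ℝ := fun x => v x - ∫ t in c..x, g t with hu
  set C := ∫ x in c..d, u x * η x with hC
  refine ⟨C, ?_⟩
  have hz := isOpen_Ioo.ae_eq_zero_of_integral_contDiff_smul_eq_zero (μ := volume)
    (U := Set.Ioo c d) (f := fun x => u x - C)
    (((intervalIntegrable_iff_integrableOn_Ioo_of_le hcd.le).1
      (hui.sub intervalIntegrable_const)).locallyIntegrableOn) ?_
  · filter_upwards [hz] with x hx hx'
    have := hx hx'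
    simp only [hu] at this
    linarith
  intro ψ hψ hψc hψs
  have hcont : ContDiff ℝ ∞ (fun x => ψ x - (∫ t in c..d, ψ t) * η x) :=
    hψ.sub (contDiff_const.mul hη)
  have hsub : tsupport (fun x => ψ x - (∫ t in c..d, ψ t) * η x) ⊆ tsupport ψ ∪ tsupport η :=
    (tsupport_sub ψ _).trans (Set.union_subset_union_right _ (tsupport_mul_subset_right))
  obtain ⟨φ, hφ, hφc, hφs, hφd⟩ := exists_testFunction_deriv_eq hcd hcont
    (hψc.sub hηc.mul_left) (hsub.trans (Set.union_subset hψs hηs)) (by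
      rw [intervalIntegral.integral_sub (hψ.continuous.intervalIntegrable _ _)
        ((hη.continuous.intervalIntegrable _ _).const_mul _),
        intervalIntegral.integral_const_mul, hη1, mul_one, sub_self])
  have h3 := key φ hφ hφc hφs
  rw [hφd] at h3
  have hψi := hui.mul_continuousOn hψ.continuous.continuousOn
  have hηi := hui.mul_continuousOn hη.continuous.continuousOn
  have h4 : ∫ x in c..d, u x * (ψ x - (∫ t in c..d, ψ t) * η x)
      = (∫ x in c..d, u x * ψ x) - (∫ t in c..d, ψ t) * C := by
    rw [hC, ← intervalIntegral.integral_const_mul, ← intervalIntegral.integral_sub hψi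
      (hηi.const_mul _)]
    congr 1 with x
    ring
  rw [← setIntegral_eq_integral_of_forall_compl_eq_zero (s := Set.Ioo c d),
    setIntegral_Ioo_eq hcd.le]
  · have h5 : ∫ x in c..d, ψ x • (u x - C) = (∫ x in c..d, u x * ψ x) - (∫ t in c..d, ψ t) * C := by
      rw [← intervalIntegral.integral_mul_const, ← intervalIntegral.integral_sub hψi
        ((hψ.continuous.intervalIntegrable _ _).mul_const _)]
      congr 1 with x
      simp only [smul_eq_mul]
      ring
    rw [h5, ← h4]
    exact h3
  · intro x hx
    rw [image_eq_zero_of_notMem_tsupport fun h => hx (hψs h), zero_smul]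

/-! ### Zeros of the Legendre polynomials -/

/-- Each differentiation removes at most one factor `X² - 1`, so a positive power of it still
divides the result. -/
theorem eval_iterate_derivative_of_lt {r k : ℕ} (hk : k < r) {x : ℝ} (hx : x ^ 2 = 1) :
    (derivative^[k] ((X ^ 2 - 1 : ℝ[X]) ^ r)).eval x = 0 := by
  obtain ⟨q, hq⟩ := pow_sub_dvd_iterate_derivative_pow (X ^ 2 - 1 : ℝ[X]) r k
  rw [hq]
  simp [hx, Nat.sub_ne_zero_of_lt hk]

/-- The power is monic of degree `2r`, so this leading coefficient is `2r (2r - 1) ⋯ (r + 1)`. It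
fixes the degree of the Legendre polynomial and rules out that an earlier derivative vanishes
identically. -/
theorem coeff_iterate_derivative_ne_zero (r : ℕ) :
    (derivative^[r] ((X ^ 2 - 1 : ℝ[X]) ^ r)).coeff r ≠ 0 := by
  have hm : ((X ^ 2 - 1 : ℝ[X]) ^ r).Monic := by
    have := (monic_X_pow_sub_C (1 : ℝ) two_ne_zero).pow r
    simpa using this
  have hd : ((X ^ 2 - 1 : ℝ[X]) ^ r).natDegree = r + r := by
    have := natDegree_X_pow_sub_C (n := 2) (r := (1 : ℝ))
    rw [C_1] at this
    rw [natDegree_pow, this]; ring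
  rw [coeff_iterate_derivative, ← hd, hm.coeff_natDegree, hd]
  simp [Nat.descFactorial_eq_zero_iff_lt]

theorem natDegree_legendre (r : ℕ) : (legendre r).natDegree = r := by
  refine natDegree_eq_of_le_of_coeff_ne_zero ?_ ?_
  · refine (natDegree_C_mul_le _ _).trans ((natDegree_iterate_derivative _ _).trans ?_)
    have : ((X ^ 2 - 1 : ℝ[X]) ^ r).natDegree ≤ r * 2 := by
      refine natDegree_pow_le.trans (Nat.mul_le_mul_left _ ?_)
      compute_degree
    omega
  · rw [legendre, coeff_C_mul]
    exact mul_ne_zero (by positivity) (coeff_iterate_derivative_ne_zero r)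

theorem legendre_ne_zero (r : ℕ) : legendre r ≠ 0 := by
  intro h
  refine coeff_iterate_derivative_ne_zero r ?_
  have : (legendre r).coeff r = 0 := by rw [h, coeff_zero]
  rw [legendre, coeff_C_mul] at this
  exact (mul_eq_zero.1 this).resolve_left (by positivity)

/-- Iterating Rolle's theorem. -/
theorem exists_roots_iterate_derivative {r k : ℕ} (hk : k ≤ r) :
    ∃ s : Finset ℝ, s.card = k ∧
      ∀ x ∈ s, x ∈ Set.Ioo (-1 : ℝ) 1 ∧ (derivative^[k] ((X ^ 2 - 1 : ℝ[X]) ^ r)).eval x = 0 := by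
  induction k with
  | zero => exact ⟨∅, rfl, by simp⟩
  | succ k ih =>
    obtain ⟨s, hs, hsr⟩ := ih (by omega)
    set p := derivative^[k] ((X ^ 2 - 1 : ℝ[X]) ^ r) with hp
    have hpd : derivative^[k + 1] ((X ^ 2 - 1 : ℝ[X]) ^ r) = derivative p := by
      rw [hp, Function.iterate_succ_apply']
    have hp0 : derivative p ≠ 0 := by
      intro h
      apply coeff_iterate_derivative_ne_zero r
      rw [show r = (r - (k + 1)) + (k + 1) by omega, Function.iterate_add_apply,
        ← show r = (r - (k + 1)) + (k + 1) by omega, hpd, h]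
      simp
    set t : Finset ℝ := (derivative p).roots.toFinset.filter (· ∈ Set.Ioo (-1 : ℝ) 1) with ht
    -- Because `k < r`, both end points `±1` are zeros of `p` as well. Rolle's theorem between
    -- neighbours among these `k + 2` zeros yields `k + 1` interior zeros of `p'`.
    have hcard : (insert (-1) (insert 1 s)).card ≤ t.card + 1 := by
      apply Finset.card_le_of_interleaved
      intro x hx y hy hxy _
      have hroot : ∀ z ∈ insert (-1) (insert 1 s), z ∈ Set.Icc (-1 : ℝ) 1 ∧ p.eval z = 0 := by
        intro z hz
        rw [Finset.mem_insert, Finset.mem_insert] at hz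
        rcases hz with rfl | rfl | hz
        · exact ⟨by norm_num, eval_iterate_derivative_of_lt (by omega) (by norm_num)⟩
        · exact ⟨by norm_num, eval_iterate_derivative_of_lt (by omega) (by norm_num)⟩
        · exact ⟨Set.Ioo_subset_Icc_self (hsr z hz).1, (hsr z hz).2⟩
      obtain ⟨z, hz, hz'⟩ := exists_deriv_eq_zero hxy p.continuousOn
        ((hroot x hx).2.trans (hroot y hy).2.symm)
      refine ⟨z, ?_, hz.1, hz.2⟩
      rw [ht, Finset.mem_filter, Multiset.mem_toFinset, mem_roots hp0]
      refine ⟨?_, (hroot x hx).1.1.trans_lt hz.1, hz.2.trans_le (hroot y hy).1.2⟩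
      rwa [Polynomial.deriv] at hz'
    rw [Finset.card_insert_of_notMem, Finset.card_insert_of_notMem, hs] at hcard
    · obtain ⟨u, hut, hu⟩ := Finset.exists_subset_card_eq (show k + 1 ≤ t.card by omega)
      refine ⟨u, hu, fun x hx => ?_⟩
      have := hut hx
      rw [ht, Finset.mem_filter, Multiset.mem_toFinset, mem_roots hp0] at this
      rw [hpd]
      exact ⟨this.2, this.1⟩
    · exact fun h => lt_irrefl _ (hsr _ h).1.2
    · rw [Finset.mem_insert, not_or]
      exact ⟨by norm_num, fun h => lt_irrefl _ (hsr _ h).1.1⟩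

/-- Rolle's theorem supplies `r` distinct interior zeros, and the degree leaves room for no others.
-/
theorem legendre_roots (r : ℕ) : (legendre r).roots.toFinset.card = r ∧
    ∀ x ∈ (legendre r).roots.toFinset, x ∈ Set.Ioo (-1 : ℝ) 1 := by
  obtain ⟨s, hs, hsr⟩ := exists_roots_iterate_derivative (le_refl r)
  have hsub : s ⊆ (legendre r).roots.toFinset := by
    intro x hx
    rw [Multiset.mem_toFinset, mem_roots (legendre_ne_zero r), IsRoot, legendre, eval_mul,
      (hsr x hx).2, mul_zero]
  have hle : (legendre r).roots.toFinset.card ≤ r :=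
    (Multiset.toFinset_card_le _).trans ((card_roots' _).trans (natDegree_legendre r).le)
  have heq := Finset.eq_of_subset_of_card_le hsub (by omega)
  rw [← heq]
  exact ⟨hs, fun x hx => (hsr x hx).1⟩

/-- The sorted list of zeros has exactly `r` entries, so the default value of `getD` is never
returned in this range. -/
theorem gaussPoint_eq_getElem {r j : ℕ} (hj : j ∈ Finset.Icc 1 r) :
    ∃ h : j - 1 < ((legendre r).roots.toFinset.sort (· ≤ ·)).length,
      gaussPoint r j = ((legendre r).roots.toFinset.sort (· ≤ ·))[j - 1] := by
  rw [Finset.mem_Icc] at hj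
  have : j - 1 < ((legendre r).roots.toFinset.sort (· ≤ ·)).length := by
    rw [Finset.length_sort, (legendre_roots r).1]; omega
  exact ⟨this, by rw [gaussPoint, List.getD_eq_getElem _ _ this]⟩

theorem gaussPoint_mem_roots {r j : ℕ} (hj : j ∈ Finset.Icc 1 r) :
    gaussPoint r j ∈ (legendre r).roots.toFinset := by
  obtain ⟨h, e⟩ := gaussPoint_eq_getElem hj
  rw [e, ← Finset.mem_sort (· ≤ ·)]
  exact List.getElem_mem h

theorem gaussPoint_mem_Ioo {r j : ℕ} (hj : j ∈ Finset.Icc 1 r) :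
    gaussPoint r j ∈ Set.Ioo (-1 : ℝ) 1 :=
  (legendre_roots r).2 _ (gaussPoint_mem_roots hj)

theorem eval_legendre_gaussPoint {r j : ℕ} (hj : j ∈ Finset.Icc 1 r) :
    (legendre r).eval (gaussPoint r j) = 0 := by
  have := gaussPoint_mem_roots hj
  rwa [Multiset.mem_toFinset, mem_roots (legendre_ne_zero r)] at this

theorem gaussPoint_lt {r j k : ℕ} (hj : j ∈ Finset.Icc 1 r) (hk : k ∈ Finset.Icc 1 r)
    (hjk : j < k) : gaussPoint r j < gaussPoint r k := by
  obtain ⟨h, e⟩ := gaussPoint_eq_getElem hj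
  obtain ⟨h', e'⟩ := gaussPoint_eq_getElem hk
  rw [e, e']
  rw [Finset.mem_Icc] at hj
  exact (Finset.sortedLT_sort _).strictMono_get (a := ⟨j - 1, h⟩) (b := ⟨k - 1, h'⟩)
    (by simp only [Fin.mk_lt_mk]; omega)

theorem gaussPoint_injOn (r : ℕ) :
    Set.InjOn (gaussPoint r) (Finset.Icc 1 r : Finset ℕ) := by
  intro j hj k hk h
  by_contra hne
  rcases lt_or_gt_of_ne hne with hlt | hlt
  · exact (gaussPoint_lt hj hk hlt).ne h
  · exact (gaussPoint_lt hk hj hlt).ne h.symm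

/-! ### Gauss quadrature -/

/-- Each integration by parts moves one derivative onto `q`. The boundary terms vanish because
derivatives of order below `r` are zero at `±1`, and the degree bound makes `k` derivatives
annihilate `q`. -/
theorem integral_iterate_derivative_mul {r k : ℕ} (hk : k ≤ r) {q : ℝ[X]} (hq : q.degree < k) :
    ∫ x in (-1 : ℝ)..1, (derivative^[k] ((X ^ 2 - 1 : ℝ[X]) ^ r)).eval x * q.eval x = 0 := by
  induction k generalizing q with
  | zero =>
    have : q = 0 := by
      rw [← degree_eq_bot, ← Nat.WithBot.lt_zero_iff]
      exact_mod_cast hq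
    simp [this]
  | succ k ih =>
    have hib := intervalIntegral.integral_mul_deriv_eq_deriv_mul (a := (-1 : ℝ)) (b := 1)
      (u := fun x => q.eval x) (u' := fun x => (derivative q).eval x)
      (v := fun x => (derivative^[k] ((X ^ 2 - 1 : ℝ[X]) ^ r)).eval x)
      (v' := fun x => (derivative^[k + 1] ((X ^ 2 - 1 : ℝ[X]) ^ r)).eval x)
      (fun x _ => q.hasDerivAt x)
      (fun x _ => by
        rw [Function.iterate_succ_apply']
        exact Polynomial.hasDerivAt _ x)
      ((Polynomial.continuous _).intervalIntegrable _ _)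
      ((Polynomial.continuous _).intervalIntegrable _ _)
    rw [eval_iterate_derivative_of_lt (by omega) (by norm_num),
      eval_iterate_derivative_of_lt (by omega) (by norm_num)] at hib
    simp_rw [mul_comm (eval _ (derivative^[k + 1] _))]
    rw [hib]
    simp_rw [mul_comm (eval _ (derivative q))]
    rw [ih (by omega)]
    · simp
    · by_cases h0 : q = 0
      · simp [h0]
      · refine (degree_derivative_lt h0).trans_le ?_
        rw [degree_eq_natDegree h0] at hq ⊢
        norm_cast at hq ⊢
        omega

theorem integral_legendre_mul {r : ℕ} {q : ℝ[X]} (hq : q.degree < r) :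
    ∫ x in (-1 : ℝ)..1, (legendre r).eval x * q.eval x = 0 := by
  simp only [legendre, eval_mul, eval_C, mul_assoc]
  rw [intervalIntegral.integral_const_mul, integral_iterate_derivative_mul le_rfl hq, mul_zero]

/-- The `j`-th Lagrange polynomial for the Gauss points. -/
noncomputable def gaussBasis (r j : ℕ) : ℝ[X] := Lagrange.basis (Finset.Icc 1 r) (gaussPoint r) j

/-- The weights of the Gauss quadrature formula on `[-1, 1]`. -/
noncomputable def gaussWeight (r j : ℕ) : ℝ := ∫ x in (-1 : ℝ)..1, (gaussBasis r j).eval x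

theorem eq_sum_gaussBasis {r : ℕ} {q : ℝ[X]} (hq : q.degree < r) :
    q = ∑ j ∈ Finset.Icc 1 r, C (q.eval (gaussPoint r j)) * gaussBasis r j := by
  conv_lhs => rw [Lagrange.eq_interpolate (gaussPoint_injOn r) (f := q) (by simpa using hq)]
  rw [Lagrange.interpolate_apply]
  rfl

/-- Divide `q` by the Legendre polynomial. The quotient has degree below `r`, so its product with
the divisor integrates to zero; the remainder agrees with `q` at the Gauss points and is recovered
there by Lagrange interpolation. -/
theorem integral_eq_sum_gaussWeight {r : ℕ} {q : ℝ[X]} (hq : q.degree < (2 * r : ℕ)) :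
    ∫ x in (-1 : ℝ)..1, q.eval x
      = ∑ j ∈ Finset.Icc 1 r, gaussWeight r j * q.eval (gaussPoint r j) := by
  have hL : (legendre r).degree = r := by
    rw [degree_eq_natDegree (legendre_ne_zero r), natDegree_legendre]
  have hmod : (q % legendre r).degree < r :=
    hL ▸ EuclideanDomain.mod_lt q (legendre_ne_zero r)
  have hdiv : (q / legendre r).degree < r := by
    by_cases h0 : q / legendre r = 0
    · rw [h0, degree_zero]; exact WithBot.bot_lt_coe _
    · have hle : (legendre r).degree ≤ q.degree := by
        by_contra h
        exact h0 ((Polynomial.div_eq_zero_iff (legendre_ne_zero r)).2 (not_le.1 h))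
      have h1 := Polynomial.degree_add_div (legendre_ne_zero r) hle
      rw [hL, degree_eq_natDegree h0] at h1
      rw [degree_eq_natDegree h0]
      rw [← h1] at hq
      norm_cast at hq ⊢
      omega
  have hq' : q = legendre r * (q / legendre r) + q % legendre r :=
    (EuclideanDomain.div_add_mod q (legendre r)).symm
  have heval : ∀ j ∈ Finset.Icc 1 r,
      q.eval (gaussPoint r j) = (q % legendre r).eval (gaussPoint r j) := by
    intro j hj
    conv_lhs => rw [hq']
    rw [eval_add, eval_mul, eval_legendre_gaussPoint hj, zero_mul, zero_add]
  calc ∫ x in (-1 : ℝ)..1, q.eval x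
      = ∫ x in (-1 : ℝ)..1, ((legendre r).eval x * (q / legendre r).eval x
          + (q % legendre r).eval x) := by
        conv_lhs => rw [hq']
        simp only [eval_add, eval_mul]
    _ = ∫ x in (-1 : ℝ)..1, (q % legendre r).eval x := by
        rw [intervalIntegral.integral_add, integral_legendre_mul hdiv, zero_add]
        · exact ((Polynomial.continuous _).mul (Polynomial.continuous _)).intervalIntegrable _ _
        · exact (Polynomial.continuous _).intervalIntegrable _ _
    _ = _ := by
        conv_lhs => rw [eq_sum_gaussBasis hmod]
        simp only [eval_finsetSum, eval_mul, eval_C]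
        rw [intervalIntegral.integral_finsetSum]
        · refine Finset.sum_congr rfl fun j hj => ?_
          rw [intervalIntegral.integral_const_mul, heval j hj, gaussWeight, mul_comm]
        · exact fun j _ => ((Polynomial.continuous _).intervalIntegrable _ _).const_mul _

theorem degree_gaussBasis_lt {r j : ℕ} (hj : j ∈ Finset.Icc 1 r) :
    (gaussBasis r j).degree < r := by
  rw [gaussBasis, Lagrange.degree_basis (gaussPoint_injOn r) hj]
  have := Finset.mem_Icc.1 hj
  simp only [Nat.card_Icc, add_tsub_cancel_right, Nat.cast_lt]
  omega

theorem eval_gaussBasis {r j k : ℕ} (hj : j ∈ Finset.Icc 1 r) (hk : k ∈ Finset.Icc 1 r) :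
    (gaussBasis r j).eval (gaussPoint r k) = if k = j then 1 else 0 := by
  split_ifs with h
  · rw [h]; exact Lagrange.eval_basis_self (gaussPoint_injOn r) hj
  · exact Lagrange.eval_basis_of_ne (Ne.symm h) hk

/-- The squared Lagrange polynomial has degree at most `2r - 2`, so its integral is computed exactly
by the quadrature and equals the weight. -/
theorem gaussWeight_pos {r j : ℕ} (hj : j ∈ Finset.Icc 1 r) : 0 < gaussWeight r j := by
  have hd := degree_gaussBasis_lt hj
  have h0 : gaussBasis r j ≠ 0 := Lagrange.basis_ne_zero (gaussPoint_injOn r) hj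
  have h1 : ∫ x in (-1 : ℝ)..1, (gaussBasis r j ^ 2).eval x = gaussWeight r j := by
    rw [integral_eq_sum_gaussWeight (r := r), Finset.sum_eq_single j]
    · rw [eval_pow, eval_gaussBasis hj hj, if_pos rfl]; ring
    · intro k hk hkj
      rw [eval_pow, eval_gaussBasis hj hk, if_neg hkj]; ring
    · exact fun h => absurd hj h
    · rw [degree_pow, degree_eq_natDegree h0] at *
      norm_cast at hd
      rw [nsmul_eq_mul]
      norm_cast
      omega
  rw [← h1]
  refine intervalIntegral.integral_pos (by norm_num) (Polynomial.continuousOn _)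
    (fun x _ => by rw [eval_pow]; positivity) ⟨gaussPoint r j,
      Set.Ioo_subset_Icc_self (gaussPoint_mem_Ioo hj), ?_⟩
  rw [eval_pow, eval_gaussBasis hj hj, if_pos rfl]; norm_num

theorem sum_gaussWeight {r : ℕ} (hr : 1 ≤ r) : ∑ j ∈ Finset.Icc 1 r, gaussWeight r j = 2 := by
  have := integral_eq_sum_gaussWeight (r := r) (q := 1) (by
    rw [degree_one]; norm_cast; omega)
  simp only [eval_one, mul_one, intervalIntegral.integral_const, smul_eq_mul] at this
  rw [← this]; norm_num

/-- The affine map from `[-1, 1]` onto `[c, d]`. -/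
noncomputable def affinePoly (c d : ℝ) : ℝ[X] := C ((d - c) / 2) * X + C ((d + c) / 2)

theorem degree_comp_affinePoly_lt {c d : ℝ} (hcd : c < d) {q : ℝ[X]} {n : ℕ}
    (hq : q.degree < n) : (q.comp (affinePoly c d)).degree < n := by
  by_cases h0 : q = 0
  · simp [h0]
  · have hl : (affinePoly c d).natDegree = 1 := natDegree_linear (by linarith)
    rw [degree_eq_natDegree h0] at hq
    refine degree_le_natDegree.trans_lt ?_
    rw [natDegree_comp, hl, mul_one]
    exact hq

theorem integral_comp_affinePoly {c d : ℝ} (f : ℝ → ℝ) :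
    ∫ x in c..d, f x = (d - c) / 2 * ∫ x in (-1 : ℝ)..1, f ((affinePoly c d).eval x) := by
  have := intervalIntegral.mul_integral_comp_mul_add (a := -1) (b := 1) (f := f) ((d - c) / 2)
    ((d + c) / 2)
  rw [show (d - c) / 2 * -1 + (d + c) / 2 = c by ring,
    show (d - c) / 2 * 1 + (d + c) / 2 = d by ring] at this
  rw [← this]
  simp [affinePoly]

/-- Gauss quadrature on `[c, d]` is exact for polynomials of degree less than `2 r`. -/
theorem integral_eq_gauss {r : ℕ} {c d : ℝ} (hcd : c < d) {q : ℝ[X]}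
    (hq : q.degree < (2 * r : ℕ)) :
    ∫ x in c..d, q.eval x = ∑ j ∈ Finset.Icc 1 r,
      (d - c) / 2 * gaussWeight r j * q.eval ((d + c + (d - c) * gaussPoint r j) / 2) := by
  have := integral_eq_sum_gaussWeight (degree_comp_affinePoly_lt hcd hq)
  simp only [eval_comp] at this
  rw [integral_comp_affinePoly, this, Finset.mul_sum]
  refine Finset.sum_congr rfl fun j _ => ?_
  rw [mul_assoc]
  congr 3
  simp [affinePoly]
  ring

/-- The constant of the inverse inequality for polynomials of degree less than `r`. -/
noncomputable def inverseConst (r : ℕ) : ℝ :=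
  4 * ∫ x in (-1 : ℝ)..1, ∑ j ∈ Finset.Icc 1 r,
    (derivative (gaussBasis r j)).eval x ^ 2 / gaussWeight r j

theorem inverseConst_nonneg (r : ℕ) : 0 ≤ inverseConst r := by
  refine mul_nonneg (by norm_num) (intervalIntegral.integral_nonneg (by norm_num) fun x _ => ?_)
  exact Finset.sum_nonneg fun j hj => div_nonneg (sq_nonneg _) (gaussWeight_pos hj).le

/-- By exact quadrature, `∫ q²` is the weighted sum of the squared Gauss values of `q`. Expanding
`q'` in derivatives of the Lagrange basis and applying Cauchy-Schwarz with these weights gives the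
bound at every point. -/
theorem sq_eval_derivative_le {r : ℕ} {q : ℝ[X]} (hq : q.degree < r) (x : ℝ) :
    (derivative q).eval x ^ 2 ≤ (∫ y in (-1 : ℝ)..1, q.eval y ^ 2) *
      ∑ j ∈ Finset.Icc 1 r, (derivative (gaussBasis r j)).eval x ^ 2 / gaussWeight r j := by
  have h1 : ∫ y in (-1 : ℝ)..1, q.eval y ^ 2
      = ∑ j ∈ Finset.Icc 1 r, gaussWeight r j * q.eval (gaussPoint r j) ^ 2 := by
    have := integral_eq_sum_gaussWeight (r := r) (q := q ^ 2) (by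
      by_cases h0 : q = 0
      · subst h0
        rw [zero_pow two_ne_zero, degree_zero]
        exact WithBot.bot_lt_coe _
      · rw [degree_pow, degree_eq_natDegree h0] at *
        rw [nsmul_eq_mul]
        norm_cast at hq ⊢
        omega)
    simpa only [eval_pow] using this
  have h2 : (derivative q).eval x
      = ∑ j ∈ Finset.Icc 1 r, q.eval (gaussPoint r j) * (derivative (gaussBasis r j)).eval x := by
    conv_lhs => rw [eq_sum_gaussBasis hq]
    simp [eval_finsetSum]
  rw [h1, h2]
  refine Finset.sum_sq_le_sum_mul_sum_of_sq_le_mul _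
    (fun j hj => mul_nonneg (gaussWeight_pos hj).le (sq_nonneg _))
    (fun j hj => div_nonneg (sq_nonneg _) (gaussWeight_pos hj).le) fun j hj => ?_
  have := (gaussWeight_pos hj).ne'
  refine le_of_eq ?_
  field_simp

/-- The inverse inequality on `[c, d]`. -/
theorem inverse_inequality {r : ℕ} {c d : ℝ} (hcd : c < d) {q : ℝ[X]} (hq : q.degree < r) :
    (d - c) ^ 2 * ∫ x in c..d, (derivative q).eval x ^ 2
      ≤ inverseConst r * ∫ x in c..d, q.eval x ^ 2 := by
  set Q := q.comp (affinePoly c d) with hQ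
  have hQd : Q.degree < r := degree_comp_affinePoly_lt hcd hq
  have hder : ∀ x, (derivative Q).eval x
      = (d - c) / 2 * (derivative q).eval ((affinePoly c d).eval x) := by
    intro x
    rw [hQ, derivative_comp, eval_mul, eval_comp]
    simp [affinePoly]
  have hint : ∫ x in (-1 : ℝ)..1, (derivative Q).eval x ^ 2 ≤
      (∫ y in (-1 : ℝ)..1, Q.eval y ^ 2) * ∫ x in (-1 : ℝ)..1, ∑ j ∈ Finset.Icc 1 r,
        (derivative (gaussBasis r j)).eval x ^ 2 / gaussWeight r j := by
    rw [← intervalIntegral.integral_const_mul]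
    refine intervalIntegral.integral_mono_on (by norm_num) ?_ ?_
      fun x _ => sq_eval_derivative_le hQd x
    · exact ((Polynomial.continuous _).pow 2).intervalIntegrable _ _
    · refine Continuous.intervalIntegrable ?_ _ _
      exact continuous_const.mul (continuous_finsetSum _ fun j _ =>
        ((Polynomial.continuous _).pow 2).div_const _)
  rw [integral_comp_affinePoly, integral_comp_affinePoly (fun x => q.eval x ^ 2)]
  simp only [hder, mul_pow, intervalIntegral.integral_const_mul] at hint
  simp only [hQ, eval_comp] at hint
  rw [inverseConst]
  have hpos : 0 < d - c := sub_pos.2 hcd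
  -- The factor 4 compensates for the squared slope `((d - c) / 2)²` of the affine map.
  have := mul_le_mul_of_nonneg_left hint (show 0 ≤ 4 * ((d - c) / 2) by linarith)
  nlinarith [this]

/-! ### `H²` functions on an interval -/

theorem MemH1.exists_eq {c d : ℝ} (hcd : c < d) {v : ℝ → ℝ} (h : MemH1 c d v) :
    ∃ C : ℝ, ∀ᵐ x, x ∈ Set.Ioo c d → v x = C + ∫ t in c..x, deriv v t :=
  h.weakDeriv.exists_ae_eq hcd (h.memLp.integrable one_le_two)
    (h.memLp_deriv.integrable one_le_two)

theorem eqOn_Ioo_of_ae {c d : ℝ} {f g : ℝ → ℝ} (hf : ContinuousOn f (Set.Ioo c d))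
    (hg : ContinuousOn g (Set.Ioo c d)) (h : ∀ᵐ x, x ∈ Set.Ioo c d → f x = g x) :
    Set.EqOn f g (Set.Ioo c d) :=
  Measure.eqOn_open_of_ae_eq ((ae_restrict_iff' measurableSet_Ioo).2 h) isOpen_Ioo hf hg

/-- Continuity of `g` is needed at the single point `x` only, which is why continuity of `α` just at
the Gauss points suffices later. -/
theorem hasDerivAt_primitive {c d : ℝ} {g : ℝ → ℝ} (hg : IntervalIntegrable g volume c d)
    {x : ℝ} (hx : x ∈ Set.Ioo c d) (hc : ContinuousAt g x) (C : ℝ) :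
    HasDerivAt (fun y => C + ∫ t in c..y, g t) (g x) x := by
  refine (intervalIntegral.integral_hasDerivAt_right (hg.mono_set ?_) ?_ hc).const_add C
  · rw [uIcc_of_le hx.1.le, uIcc_of_le (hx.1.trans hx.2).le]
    exact Set.Icc_subset_Icc_right hx.2.le
  · rw [intervalIntegrable_iff_integrableOn_Ioo_of_le (hx.1.trans hx.2).le] at hg
    exact ⟨Set.Ioo c d, Ioo_mem_nhds hx.1 hx.2, hg.aestronglyMeasurable⟩

/-- The function `v` is continuous on `[c, d]` and continuously differentiable in `(c, d)`, and its
derivative `G` is a primitive of the square integrable function `g`. -/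
structure HasH2Data (c d : ℝ) (v G g : ℝ → ℝ) : Prop where
  cont : ContinuousOn v (Set.Icc c d)
  hasDerivAt : ∀ x ∈ Set.Ioo c d, HasDerivAt v (G x) x
  memLp : MemLp g 2 (volume.restrict (Set.Ioo c d))
  eq_primitive : ∀ x ∈ Set.Icc c d, G x = G c + ∫ t in c..x, g t

/-- Du Bois-Reymond is applied twice: `deriv v` agrees almost everywhere with a continuous primitive
`G`, and the continuous `v` agrees everywhere in the interior with a primitive of `G`, hence is
classically differentiable there. -/
theorem MemH2.exists_hasH2Data {c d : ℝ} (hcd : c < d) {v : ℝ → ℝ} (h : MemH2 c d v)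
    (hv : ContinuousOn v (Set.Icc c d)) : ∃ G g, HasH2Data c d v G g := by
  obtain ⟨C, hC⟩ := h.memH1.exists_eq hcd
  obtain ⟨D, hD⟩ := h.memH1_deriv.exists_eq hcd
  set g := deriv (deriv v)
  have hgi : IntervalIntegrable g volume c d :=
    intervalIntegrable_of_Ioo hcd.le (h.memH1_deriv.memLp_deriv.integrable one_le_two)
  have hvi : IntervalIntegrable (deriv v) volume c d :=
    intervalIntegrable_of_Ioo hcd.le (h.memH1.memLp_deriv.integrable one_le_two)
  have hGc : ContinuousOn (fun x => D + ∫ t in c..x, g t) (Set.Icc c d) :=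
    IntervalIntegrable.continuousOn_primitive hcd.le hgi D
  have hGi : IntervalIntegrable (fun x => D + ∫ t in c..x, g t) volume c d := by
    apply ContinuousOn.intervalIntegrable
    rwa [uIcc_of_le hcd.le]
  have hint : ∀ x ∈ Set.Ioo c d, ∫ t in c..x, deriv v t = ∫ t in c..x, (D + ∫ s in c..t, g s) := by
    intro x hx
    apply intervalIntegral.integral_congr_ae
    filter_upwards [hD] with t ht ht'
    rw [uIoc_of_le hx.1.le] at ht'
    exact ht ⟨ht'.1, ht'.2.trans_lt hx.2⟩
  have heq := eqOn_Ioo_of_ae (hv.mono Set.Ioo_subset_Icc_self)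
    ((IntervalIntegrable.continuousOn_primitive hcd.le hvi C).mono Set.Ioo_subset_Icc_self) hC
  refine ⟨fun x => D + ∫ t in c..x, g t, g, hv, fun x hx => ?_, h.memH1_deriv.memLp_deriv,
    fun x _ => by simp⟩
  refine (hasDerivAt_primitive hGi hx ?_ C).congr_of_eventuallyEq ?_
  · exact hGc.continuousAt (Icc_mem_nhds hx.1 hx.2)
  · filter_upwards [Ioo_mem_nhds hx.1 hx.2] with y hy
    rw [heq hy]
    exact congrArg _ (hint y hy)

theorem memLp_two_of_continuousOn {c d : ℝ} {f : ℝ → ℝ} (h : ContinuousOn f (Set.Icc c d)) :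
    MemLp f 2 (volume.restrict (Set.Ioo c d)) := by
  refine (memLp_two_iff_integrable_sq ?_).2 ?_
  · exact (h.mono Set.Ioo_subset_Icc_self).aestronglyMeasurable measurableSet_Ioo
  · exact ((h.pow 2).integrableOn_Icc).mono_set Set.Ioo_subset_Icc_self

theorem hasH2Data_of_polynomial {c d : ℝ} {v : ℝ → ℝ} {p : ℝ[X]}
    (h : ∀ x ∈ Set.Icc c d, v x = p.eval x) :
    HasH2Data c d v (fun x => (derivative p).eval x)
      (fun x => (derivative (derivative p)).eval x) where
  cont := p.continuousOn.congr h
  hasDerivAt x hx := (p.hasDerivAt x).congr_of_eventuallyEq (by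
    filter_upwards [Icc_mem_nhds hx.1 hx.2] with y hy using h y hy)
  memLp := memLp_two_of_continuousOn (Polynomial.continuousOn _)
  eq_primitive x _ := by
    rw [intervalIntegral.integral_eq_sub_of_hasDerivAt
      (fun t _ => (derivative p).hasDerivAt t)
      ((Polynomial.continuous _).intervalIntegrable _ _)]
    ring

theorem uIcc_subset_Icc_of_mem {c d x : ℝ} (hx : x ∈ Set.Icc c d) :
    Set.uIcc c x ⊆ Set.uIcc c d := by
  rw [uIcc_of_le hx.1, uIcc_of_le (hx.1.trans hx.2)]
  exact Set.Icc_subset_Icc_right hx.2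

/-- Cauchy-Schwarz inequality for an integral over an interval. -/
theorem sq_integral_abs_le {c d : ℝ} (hcd : c < d) {f : ℝ → ℝ}
    (hf : MemLp f 2 (volume.restrict (Set.Ioo c d))) :
    (∫ x in c..d, |f x|) ^ 2 ≤ (d - c) * ∫ x in c..d, f x ^ 2 := by
  have hi : IntervalIntegrable f volume c d :=
    intervalIntegrable_of_Ioo hcd.le (hf.integrable one_le_two)
  have hi2 : IntervalIntegrable (fun x => f x ^ 2) volume c d :=
    intervalIntegrable_of_Ioo hcd.le hf.integrable_sq
  set A := ∫ x in c..d, |f x| with hA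
  -- Up to a factor this is the variance of `|f|` about its mean `A / (d - c)`.
  have h0 : 0 ≤ ∫ x in c..d, ((d - c) * |f x| - A) ^ 2 :=
    intervalIntegral.integral_nonneg hcd.le fun x _ => sq_nonneg _
  have h1 : ∫ x in c..d, ((d - c) * |f x| - A) ^ 2
      = (d - c) ^ 2 * (∫ x in c..d, f x ^ 2) - 2 * (d - c) * A * A + A ^ 2 * (d - c) := by
    have : ∀ x, ((d - c) * |f x| - A) ^ 2
        = (d - c) ^ 2 * f x ^ 2 - 2 * (d - c) * A * |f x| + A ^ 2 := by
      intro x; rw [← sq_abs (f x)]; ring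
    simp only [this]
    rw [intervalIntegral.integral_add ((hi2.const_mul _).sub (hi.abs.const_mul _))
      intervalIntegrable_const, intervalIntegral.integral_sub (hi2.const_mul _)
      (hi.abs.const_mul _), intervalIntegral.integral_const_mul,
      intervalIntegral.integral_const_mul, intervalIntegral.integral_const, ← hA, smul_eq_mul]
    ring
  have hpos : 0 < d - c := sub_pos.2 hcd
  rw [h1] at h0
  nlinarith [(mul_le_mul_iff_right₀ hpos).1
    (show (d - c) * A ^ 2 ≤ (d - c) * ((d - c) * ∫ x in c..d, f x ^ 2) by nlinarith)]

theorem abs_integral_le_integral_abs {c d x y : ℝ} {f : ℝ → ℝ}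
    (hf : IntervalIntegrable f volume c d) (hcx : c ≤ x) (hxy : x ≤ y) (hyd : y ≤ d) :
    |∫ t in x..y, f t| ≤ ∫ t in c..d, |f t| :=
  (intervalIntegral.abs_integral_le_integral_abs hxy).trans
    (intervalIntegral.integral_mono_interval hcx hxy hyd
      (Filter.Eventually.of_forall fun _ => abs_nonneg _) hf.abs)

namespace HasH2Data

variable {c d : ℝ} {v G g v₁ G₁ g₁ v₂ G₂ g₂ : ℝ → ℝ}

theorem intervalIntegrable (h : HasH2Data c d v G g) (hcd : c < d) :
    IntervalIntegrable g volume c d :=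
  intervalIntegrable_of_Ioo hcd.le (h.memLp.integrable one_le_two)

theorem continuousOn_deriv (h : HasH2Data c d v G g) (hcd : c < d) :
    ContinuousOn G (Set.Icc c d) :=
  (IntervalIntegrable.continuousOn_primitive hcd.le (h.intervalIntegrable hcd) (G c)).congr
    h.eq_primitive

theorem deriv_eq (h : HasH2Data c d v G g) {x : ℝ} (hx : x ∈ Set.Ioo c d) : deriv v x = G x :=
  (h.hasDerivAt x hx).deriv

theorem ae_deriv_deriv_eq (h : HasH2Data c d v G g) (hcd : c < d) :
    ∀ᵐ x, x ∈ Set.Ioo c d → deriv (deriv v) x = g x := by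
  filter_upwards [(h.intervalIntegrable hcd).ae_hasDerivAt_integral] with x hx hx'
  refine (((hx ?_ c (by simp)).const_add (G c)).congr_of_eventuallyEq ?_).deriv
  · rw [uIcc_of_le hcd.le]; exact Set.Ioo_subset_Icc_self hx'
  · filter_upwards [Ioo_mem_nhds hx'.1 hx'.2] with y hy
    rw [h.deriv_eq hy, h.eq_primitive y (Set.Ioo_subset_Icc_self hy)]

theorem lin (h₁ : HasH2Data c d v₁ G₁ g₁) (h₂ : HasH2Data c d v₂ G₂ g₂) (hcd : c < d) (s t : ℝ) :
    HasH2Data c d (fun x => s * v₁ x + t * v₂ x) (fun x => s * G₁ x + t * G₂ x)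
      (fun x => s * g₁ x + t * g₂ x) where
  cont := (continuousOn_const.mul h₁.cont).add (continuousOn_const.mul h₂.cont)
  hasDerivAt x hx := ((h₁.hasDerivAt x hx).const_mul s).add ((h₂.hasDerivAt x hx).const_mul t)
  memLp := (h₁.memLp.const_mul s).add (h₂.memLp.const_mul t)
  eq_primitive x hx := by
    have i₁ := (h₁.intervalIntegrable hcd).mono_set (uIcc_subset_Icc_of_mem hx)
    have i₂ := (h₂.intervalIntegrable hcd).mono_set (uIcc_subset_Icc_of_mem hx)
    rw [h₁.eq_primitive x hx, h₂.eq_primitive x hx,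
      intervalIntegral.integral_add (i₁.const_mul s) (i₂.const_mul t),
      intervalIntegral.integral_const_mul, intervalIntegral.integral_const_mul]
    ring

theorem integral_sq_deriv (h : HasH2Data c d v G g) (hcd : c < d) :
    ∫ x in Set.Ioo c d, deriv v x ^ 2 = ∫ x in c..d, G x ^ 2 := by
  rw [← setIntegral_Ioo_eq hcd.le]
  exact setIntegral_congr_fun measurableSet_Ioo fun x hx => by simp only [h.deriv_eq hx]

theorem integral_sq_deriv_deriv (h : HasH2Data c d v G g) (hcd : c < d) :
    ∫ x in Set.Ioo c d, deriv (deriv v) x ^ 2 = ∫ x in c..d, g x ^ 2 := by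
  rw [← setIntegral_Ioo_eq hcd.le]
  refine setIntegral_congr_ae measurableSet_Ioo ?_
  filter_upwards [h.ae_deriv_deriv_eq hcd] with x hx hx'
  rw [hx hx']

theorem sub_eq_integral (h : HasH2Data c d v G g) (hcd : c < d) {x y : ℝ} (hx : c ≤ x)
    (hxy : x ≤ y) (hy : y ≤ d) : v y - v x = ∫ t in x..y, G t := by
  rw [intervalIntegral.integral_eq_sub_of_hasDerivAt_of_le hxy
    (h.cont.mono (Set.Icc_subset_Icc hx hy))
    (fun t ht => h.hasDerivAt t ⟨hx.trans_lt ht.1, ht.2.trans_le hy⟩)]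
  apply ContinuousOn.intervalIntegrable
  rw [uIcc_of_le hxy]
  exact (h.continuousOn_deriv hcd).mono (Set.Icc_subset_Icc hx hy)

/-- The point values of the derivative of an `H²` function. -/
theorem sq_deriv_le (h : HasH2Data c d v G g) (hcd : c < d) {x : ℝ} (hx : x ∈ Set.Icc c d) :
    (d - c) * G x ^ 2 ≤ 2 * (∫ t in c..d, G t ^ 2) + 2 * (d - c) ^ 2 * ∫ t in c..d, g t ^ 2 := by
  have hgi := h.intervalIntegrable hcd
  have hGc := h.continuousOn_deriv hcd
  set A := ∫ t in c..d, |g t| with hA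
  have hA2 : A ^ 2 ≤ (d - c) * ∫ t in c..d, g t ^ 2 := sq_integral_abs_le hcd h.memLp
  have hA0 : 0 ≤ A := intervalIntegral.integral_nonneg hcd.le fun _ _ => abs_nonneg _
  have hle : ∀ y ∈ Set.Icc c d, |G x - G y| ≤ A := by
    intro y hy
    have i₁ := hgi.mono_set (uIcc_subset_Icc_of_mem hx)
    have i₂ := hgi.mono_set (uIcc_subset_Icc_of_mem hy)
    have : G x - G y = ∫ t in y..x, g t := by
      rw [h.eq_primitive x hx, h.eq_primitive y hy, add_sub_add_left_eq_sub,
        intervalIntegral.integral_interval_sub_left i₁ i₂]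
    rw [this]
    rcases le_total y x with hyx | hxy
    · exact abs_integral_le_integral_abs hgi hy.1 hyx hx.2
    · rw [intervalIntegral.integral_symm, abs_neg]
      exact abs_integral_le_integral_abs hgi hx.1 hxy hy.2
  have hGi : IntervalIntegrable (fun t => G t ^ 2) volume c d := by
    apply ContinuousOn.intervalIntegrable
    rw [uIcc_of_le hcd.le]
    exact hGc.pow 2
  -- `G` oscillates by at most `A`, so `G(x)² ≤ 2 G(y)² + 2 A²` for every `y`; integrate this over
  -- `y`.
  have hmono : ∫ _ in c..d, G x ^ 2 ≤ ∫ y in c..d, (2 * G y ^ 2 + 2 * A ^ 2) := by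
    refine intervalIntegral.integral_mono_on hcd.le intervalIntegrable_const
      ((hGi.const_mul 2).add intervalIntegrable_const) fun y hy => ?_
    have h1 := sq_le_sq' (by linarith [neg_abs_le (G x - G y), hle y hy])
      ((le_abs_self _).trans (hle y hy))
    nlinarith [sq_nonneg (G x - 2 * G y)]
  rw [intervalIntegral.integral_const, intervalIntegral.integral_add (hGi.const_mul 2)
    intervalIntegrable_const, intervalIntegral.integral_const_mul,
    intervalIntegral.integral_const, smul_eq_mul, smul_eq_mul] at hmono
  nlinarith [mul_le_mul_of_nonneg_left hA2 (sub_pos.2 hcd).le]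

end HasH2Data

/-! ### Summation formulas -/

theorem sum_Icc_one_eq_sum_range (f : ℕ → ℝ) (n : ℕ) :
    ∑ j ∈ Finset.Icc 1 n, f j = ∑ k ∈ Finset.range n, f (k + 1) := by
  induction n with
  | zero => simp
  | succ n ih => rw [Finset.sum_Icc_succ_top (by omega), ih, Finset.sum_range_succ]

theorem sum_Icc_one_sub_pred (F : ℕ → ℝ) (n : ℕ) :
    ∑ i ∈ Finset.Icc 1 n, (F i - F (i - 1)) = F n - F 0 := by
  rw [sum_Icc_one_eq_sum_range]
  exact Finset.sum_range_sub F n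

/-- Abel summation on one element: the indices `0` and `n + 1` are its end points, and only they
leave boundary terms. -/
theorem sum_jump_mul_add_sum_mul_sub (e F : ℕ → ℝ) (n : ℕ) :
    ∑ j ∈ Finset.Icc 1 n, (e j - e (j - 1)) * F j
      + ∑ j ∈ Finset.range (n + 1), e j * (F (j + 1) - F j) = e n * F (n + 1) - e 0 * F 0 := by
  rw [sum_Icc_one_eq_sum_range]
  induction n with
  | zero => simp; ring
  | succ n ih =>
    rw [Finset.sum_range_succ, Finset.sum_range_succ _ (n + 1)]
    simp only [add_tsub_cancel_right] at ih ⊢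
    linarith

/-! ### Geometry of the partitions -/

variable {a b : ℝ}

theorem Partition.h_pos (P : Partition a b) {i : ℕ} (hi : i ∈ Finset.Icc 1 P.N) : 0 < P.h i :=
  sub_pos.2 (P.lt i hi)

theorem Partition.x_le (P : Partition a b) {i k : ℕ} (hik : i ≤ k) (hk : k ≤ P.N) :
    P.x i ≤ P.x k := by
  induction k, hik using Nat.le_induction with
  | base => exact le_rfl
  | succ k hk' ih =>
    exact (ih (by omega)).trans (P.lt (k + 1) (Finset.mem_Icc.2 ⟨by omega, hk⟩)).le

theorem Partition.le_x (P : Partition a b) {i : ℕ} (hi : i ≤ P.N) : a ≤ P.x i :=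
  P.x_zero.symm.le.trans (P.x_le (Nat.zero_le i) hi)

theorem Partition.x_le_right (P : Partition a b) {i : ℕ} (hi : i ≤ P.N) : P.x i ≤ b := by
  have := P.x_le hi le_rfl
  rwa [P.x_N] at this

theorem Partition.bounds (P : Partition a b) {i : ℕ} (hi : i ∈ Finset.Icc 1 P.N) :
    a ≤ P.x (i - 1) ∧ P.x (i - 1) < P.x i ∧ P.x i ≤ b := by
  have h := Finset.mem_Icc.1 hi
  exact ⟨P.le_x (by omega), P.lt i hi, P.x_le_right h.2⟩

theorem Partition.h_le (P : Partition a b) {i : ℕ} (hi : i ∈ Finset.Icc 1 P.N) :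
    P.h i ≤ b - a := by
  have := P.bounds hi
  rw [Partition.h]
  linarith

theorem gpt_eq (P : Partition a b) {r j : ℕ} (i : ℕ) (hj : j ≤ r) :
    gpt P r i j = (P.x i + P.x (i - 1) + (P.x i - P.x (i - 1)) * gaussPoint r j) / 2 := by
  rw [gpt, if_neg (by omega), Partition.h]

theorem gpt_succ (P : Partition a b) {r : ℕ} (hr : 1 ≤ r) (i : ℕ) :
    gpt P r i (r + 1) = gpt P r (i + 1) 1 := by
  rw [gpt, if_pos rfl, gpt, if_neg (by omega)]
  simp

theorem gpt_mem (P : Partition a b) {r i j : ℕ} (hi : i ∈ Finset.Icc 1 P.N)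
    (hj : j ∈ Finset.Icc 1 r) : gpt P r i j ∈ Set.Ioo (P.x (i - 1)) (P.x i) := by
  have hG := gaussPoint_mem_Ioo hj
  have := P.lt i hi
  rw [gpt_eq P i (Finset.mem_Icc.1 hj).2]
  constructor <;> nlinarith [hG.1, hG.2]

theorem gpt_mem_Ioo (P : Partition a b) {r i j : ℕ} (hi : i ∈ Finset.Icc 1 P.N)
    (hj : j ∈ Finset.Icc 1 r) : gpt P r i j ∈ Set.Ioo a b := by
  have h := gpt_mem P hi hj
  have := P.bounds hi
  exact ⟨this.1.trans_lt h.1, h.2.trans_le this.2.2⟩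

/-- The end points `x_{i-1}` and `x_i` of `τ_i` together with the Gauss points between them. -/
noncomputable def node (P : Partition a b) (r i j : ℕ) : ℝ :=
  if j = 0 then P.x (i - 1) else if j = r + 1 then P.x i else gpt P r i j

theorem node_zero (P : Partition a b) (r i : ℕ) : node P r i 0 = P.x (i - 1) := by
  simp [node]

theorem node_last (P : Partition a b) (r i : ℕ) : node P r i (r + 1) = P.x i := by
  simp [node]

theorem node_eq_gpt (P : Partition a b) {r j : ℕ} (i : ℕ) (hj : j ∈ Finset.Icc 1 r) :
    node P r i j = gpt P r i j := by
  have := Finset.mem_Icc.1 hj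
  rw [node, if_neg (by omega), if_neg (by omega)]

theorem node_mem (P : Partition a b) {r i j : ℕ} (hi : i ∈ Finset.Icc 1 P.N) (hj : j ≤ r + 1) :
    node P r i j ∈ Set.Icc (P.x (i - 1)) (P.x i) := by
  have := P.lt i hi
  rcases Nat.eq_zero_or_pos j with rfl | h0
  · rw [node_zero]; exact ⟨le_rfl, this.le⟩
  rcases hj.eq_or_lt with rfl | h1
  · rw [node_last]; exact ⟨this.le, le_rfl⟩
  have hj' : j ∈ Finset.Icc 1 r := Finset.mem_Icc.2 ⟨h0, by omega⟩
  rw [node_eq_gpt P i hj']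
  exact Set.Ioo_subset_Icc_self (gpt_mem P hi hj')

theorem node_le (P : Partition a b) {r i j : ℕ} (hi : i ∈ Finset.Icc 1 P.N) (hj : j ≤ r) :
    node P r i j ≤ node P r i (j + 1) := by
  rcases Nat.eq_zero_or_pos j with rfl | h0
  · rw [node_zero]; exact (node_mem P hi (by omega)).1
  rcases hj.eq_or_lt with rfl | h1
  · rw [node_last]; exact (node_mem P hi (by omega)).2
  have h2 : j ∈ Finset.Icc 1 r := Finset.mem_Icc.2 ⟨h0, by omega⟩
  have h3 : j + 1 ∈ Finset.Icc 1 r := Finset.mem_Icc.2 ⟨by omega, by omega⟩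
  rw [node_eq_gpt P i h2, node_eq_gpt P i h3, gpt_eq P i (by omega), gpt_eq P i (by omega)]
  nlinarith [gaussPoint_lt h2 h3 (by omega), P.lt i hi]

theorem intervalIntegrable_node {P : Partition a b} {r i j k : ℕ} {q : ℝ → ℝ}
    (hi : i ∈ Finset.Icc 1 P.N) (hq : IntervalIntegrable q volume (P.x (i - 1)) (P.x i))
    (hj : j ≤ r + 1) (hk : k ≤ r + 1) :
    IntervalIntegrable q volume (node P r i j) (node P r i k) := by
  refine hq.mono_set ?_
  rw [uIcc_of_le (P.lt i hi).le]
  exact Set.uIcc_subset_Icc (node_mem P hi hj) (node_mem P hi hk)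

theorem sum_integral_node {P : Partition a b} {r i : ℕ} {q : ℝ → ℝ}
    (hi : i ∈ Finset.Icc 1 P.N) (hq : IntervalIntegrable q volume (P.x (i - 1)) (P.x i)) :
    ∑ j ∈ Finset.range (r + 1), ∫ x in node P r i j..node P r i (j + 1), q x
      = ∫ x in P.x (i - 1)..P.x i, q x := by
  rw [intervalIntegral.sum_integral_adjacent_intervals, node_zero, node_last]
  exact fun k hk => intervalIntegrable_node hi hq (by omega) (by omega)

/-! ### Coefficients of the test functions -/

theorem extCoef_one_zero (P : Partition a b) (r : ℕ) (w : ℕ → ℕ → ℝ) : extCoef P r w 1 0 = 0 := by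
  simp [extCoef]

theorem extCoef_last (P : Partition a b) (r : ℕ) (w : ℕ → ℕ → ℝ) : extCoef P r w P.N r = 0 := by
  simp [extCoef]

theorem extCoef_succ_zero (P : Partition a b) {r i : ℕ} (hr : 1 ≤ r) (hi : 1 ≤ i) (w : ℕ → ℕ → ℝ) :
    extCoef P r w (i + 1) 0 = w i r := by
  rw [extCoef, if_neg (by omega), if_pos rfl, add_tsub_cancel_right]

theorem extCoef_eq (P : Partition a b) {r i j : ℕ} (w : ℕ → ℕ → ℝ)
    (hj : j ∈ Finset.Icc 1 (rIdx P r i)) : extCoef P r w i j = w i j := by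
  have := Finset.mem_Icc.1 hj
  rw [rIdx] at this
  rw [extCoef, if_neg, if_neg (by omega)]
  split_ifs at this <;> omega

theorem extCoef_succ_zero_eq_last (P : Partition a b) {r i : ℕ} (hr : 1 ≤ r) (hi : 1 ≤ i)
    (hN : i ≠ P.N) (w : ℕ → ℕ → ℝ) : extCoef P r w (i + 1) 0 = extCoef P r w i r := by
  rw [extCoef_succ_zero P hr hi, extCoef_eq]
  rw [rIdx, if_neg hN]
  exact Finset.mem_Icc.2 ⟨hr, le_rfl⟩

/-- The volume terms of the finite volume form, arranged element by element. -/
theorem sum_mul_integral_gpt {P : Partition a b} {r : ℕ} (hr : 1 ≤ r) (w : ℕ → ℕ → ℝ) {q : ℝ → ℝ}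
    (hq : ∀ i ∈ Finset.Icc 1 P.N, IntervalIntegrable q volume (P.x (i - 1)) (P.x i)) :
    ∑ i ∈ Finset.Icc 1 P.N, ∑ j ∈ Finset.Icc 1 (rIdx P r i),
      w i j * ∫ x in gpt P r i j..gpt P r i (j + 1), q x
    = ∑ i ∈ Finset.Icc 1 P.N, ∑ j ∈ Finset.range (r + 1),
      extCoef P r w i j * ∫ x in node P r i j..node P r i (j + 1), q x := by
  obtain ⟨s, rfl⟩ : ∃ s, r = s + 1 := ⟨r - 1, by omega⟩
  -- A control volume straddling `x_i` is cut there, and its right piece is assigned to element `i +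
  -- 1`. `S i` is the piece received by element `i`, so the two arrangements differ by a telescoping
  -- sum. The value at `N + 1` is set to zero because no element follows.
  set S : ℕ → ℝ := fun i => if i = P.N + 1 then 0 else
    extCoef P (s + 1) w i 0 * ∫ x in P.x (i - 1)..gpt P (s + 1) i 1, q x with hS
  have hone : 1 ∈ Finset.Icc 1 (s + 1) := Finset.mem_Icc.2 ⟨le_rfl, by omega⟩
  have hlast : s + 1 ∈ Finset.Icc 1 (s + 1) := Finset.mem_Icc.2 ⟨by omega, le_rfl⟩
  have key : ∀ i ∈ Finset.Icc 1 P.N, ∑ j ∈ Finset.Icc 1 (rIdx P (s + 1) i),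
      w i j * ∫ x in gpt P (s + 1) i j..gpt P (s + 1) i (j + 1), q x
      = ∑ j ∈ Finset.range (s + 1 + 1), extCoef P (s + 1) w i j *
          (∫ x in node P (s + 1) i j..node P (s + 1) i (j + 1), q x)
        + (S (i + 1) - S (i + 1 - 1)) := by
    intro i hi
    have hi' := Finset.mem_Icc.1 hi
    have hmid : ∑ j ∈ Finset.Icc 1 s, w i j * ∫ x in gpt P (s + 1) i j..gpt P (s + 1) i (j + 1), q x
        = ∑ k ∈ Finset.range s, extCoef P (s + 1) w i (k + 1) *
          ∫ x in node P (s + 1) i (k + 1)..node P (s + 1) i (k + 1 + 1), q x := by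
      rw [sum_Icc_one_eq_sum_range]
      refine Finset.sum_congr rfl fun k hk => ?_
      have hk' := Finset.mem_range.1 hk
      rw [node_eq_gpt P i (Finset.mem_Icc.2 ⟨by omega, by omega⟩),
        node_eq_gpt P i (Finset.mem_Icc.2 ⟨by omega, by omega⟩), extCoef_eq]
      rw [rIdx]
      split_ifs <;> exact Finset.mem_Icc.2 ⟨by omega, by omega⟩
    have hSi : S i = extCoef P (s + 1) w i 0 * ∫ x in node P (s + 1) i 0..node P (s + 1) i 1, q x := by
      rw [hS, node_zero, node_eq_gpt P i hone]
      simp only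
      rw [if_neg (by omega)]
    rw [Finset.sum_range_succ, Finset.sum_range_succ', ← hmid, node_last, zero_add, ← hSi,
      add_tsub_cancel_right, node_eq_gpt P i hlast]
    by_cases hN : i = P.N
    · have hSN : S (i + 1) = 0 := by rw [hS]; simp [hN]
      rw [hSN, rIdx, if_pos hN, add_tsub_cancel_right, hN, extCoef_last]
      ring
    · have hi1 : i + 1 ∈ Finset.Icc 1 P.N := Finset.mem_Icc.2 ⟨by omega, by omega⟩
      have hSN : S (i + 1) = w i (s + 1) * ∫ x in P.x i..gpt P (s + 1) (i + 1) 1, q x := by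
        rw [hS]
        simp only
        rw [if_neg (by omega), extCoef_succ_zero P hr hi'.1, add_tsub_cancel_right]
      have i₁ := intervalIntegrable_node (r := s + 1) (j := s + 1) (k := s + 1 + 1) hi (hq i hi)
        (by omega) (by omega)
      have i₂ := intervalIntegrable_node (r := s + 1) (j := 0) (k := 1) hi1 (hq _ hi1)
        (by omega) (by omega)
      rw [node_last, node_eq_gpt P i hlast] at i₁
      rw [node_zero, node_eq_gpt P _ hone, add_tsub_cancel_right] at i₂
      rw [rIdx, if_neg hN, Finset.sum_Icc_succ_top (by omega), hSN, gpt_succ P hr,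
        ← intervalIntegral.integral_add_adjacent_intervals i₁ i₂, extCoef_eq]
      · ring
      · rw [rIdx, if_neg hN]; exact hlast
  rw [Finset.sum_congr rfl key, Finset.sum_add_distrib,
    sum_Icc_one_eq_sum_range (fun i => S (i + 1) - S (i + 1 - 1))]
  simp only [add_tsub_cancel_right]
  rw [Finset.sum_range_sub (fun i => S (i + 1)), hS]
  simp [extCoef_one_zero]

/-- The jump terms cancel the boundary terms of the volume integrals. -/
theorem sum_jump_mul_add_sum_extCoef_mul {P : Partition a b} {r : ℕ} (hr : 1 ≤ r)
    (w : ℕ → ℕ → ℝ) (F : ℝ → ℝ) :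
    ∑ i ∈ Finset.Icc 1 P.N, ∑ j ∈ Finset.Icc 1 r, jump P r w i j * F (gpt P r i j)
      + ∑ i ∈ Finset.Icc 1 P.N, ∑ j ∈ Finset.range (r + 1),
        extCoef P r w i j * (F (node P r i (j + 1)) - F (node P r i j)) = 0 := by
  -- `T i` is the boundary term at `x_i` shared by the two adjacent elements. At `i = N` the
  -- coefficient with index `N + 1` would be arbitrary, so zero is imposed.
  set T : ℕ → ℝ := fun i => if i = P.N then 0 else extCoef P r w (i + 1) 0 * F (P.x i) with hT
  rw [← Finset.sum_add_distrib]
  have key : ∀ i ∈ Finset.Icc 1 P.N,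
      ∑ j ∈ Finset.Icc 1 r, jump P r w i j * F (gpt P r i j)
        + ∑ j ∈ Finset.range (r + 1),
          extCoef P r w i j * (F (node P r i (j + 1)) - F (node P r i j)) = T i - T (i - 1) := by
    intro i hi
    have hi' := Finset.mem_Icc.1 hi
    have h1 := sum_jump_mul_add_sum_mul_sub (extCoef P r w i) (fun j => F (node P r i j)) r
    simp only [node_last, node_zero] at h1
    have h2 : ∑ j ∈ Finset.Icc 1 r, jump P r w i j * F (gpt P r i j)
        = ∑ j ∈ Finset.Icc 1 r, (extCoef P r w i j - extCoef P r w i (j - 1)) *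
          F (node P r i j) :=
      Finset.sum_congr rfl fun j hj => by rw [jump, node_eq_gpt P i hj]
    rw [h2, h1]
    congr 1
    · rw [hT]
      simp only
      split_ifs with hN
      · rw [hN, extCoef_last, zero_mul]
      · rw [extCoef_succ_zero_eq_last P hr hi'.1 hN]
    · rw [hT]
      simp only
      rw [if_neg (by omega), Nat.sub_add_cancel hi'.1]
  rw [Finset.sum_congr rfl key, sum_Icc_one_sub_pred, hT]
  simp [extCoef_one_zero]

/-- The pairing with a test function as a sum of integrals over control volumes. -/
theorem pairing_eq {P : Partition a b} {r : ℕ} (hr : 1 ≤ r) (w : ℕ → ℕ → ℝ) {f : ℝ → ℝ}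
    (hf : IntervalIntegrable f volume a b) :
    pairing f P r w = ∑ i ∈ Finset.Icc 1 P.N, ∑ j ∈ Finset.Icc 1 (rIdx P r i),
      w i j * ∫ x in gpt P r i j..gpt P r i (j + 1), f x := by
  have hab : a ≤ b := (P.le_x le_rfl).trans_eq P.x_N
  have hind : ∀ s t : ℝ, IntervalIntegrable
      (fun x => (Set.Icc s t).indicator f x) volume a b := by
    intro s t
    rw [intervalIntegrable_iff] at hf ⊢
    exact hf.indicator measurableSet_Icc
  have hpt : ∀ x, f x * testFun P r w x = ∑ i ∈ Finset.Icc 1 P.N,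
      ∑ j ∈ Finset.Icc 1 (rIdx P r i),
        w i j * (Set.Icc (gpt P r i j) (gpt P r i (j + 1))).indicator f x := by
    intro x
    rw [testFun, Finset.mul_sum]
    refine Finset.sum_congr rfl fun i _ => ?_
    rw [Finset.mul_sum]
    refine Finset.sum_congr rfl fun j _ => ?_
    by_cases hx : x ∈ Set.Icc (gpt P r i j) (gpt P r i (j + 1))
    · simp [hx]; ring
    · simp [hx]
  rw [pairing]
  simp only [hpt]
  have hsum : ∀ i ∈ Finset.Icc 1 P.N, IntervalIntegrable (fun x => ∑ j ∈ Finset.Icc 1 (rIdx P r i),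
      w i j * (Set.Icc (gpt P r i j) (gpt P r i (j + 1))).indicator f x) volume a b := by
    intro i _
    have := IntervalIntegrable.sum (Finset.Icc 1 (rIdx P r i)) (fun j _ =>
      (hind (gpt P r i j) (gpt P r i (j + 1))).const_mul (w i j))
    simpa only [Finset.sum_fn] using this
  rw [intervalIntegral.integral_finsetSum hsum]
  refine Finset.sum_congr rfl fun i hi => ?_
  rw [intervalIntegral.integral_finsetSum fun j _ => (hind _ _).const_mul _]
  refine Finset.sum_congr rfl fun j hj => ?_
  rw [intervalIntegral.integral_const_mul]
  congr 1
  have hi' := Finset.mem_Icc.1 hi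
  have hj' := Finset.mem_Icc.1 hj
  have hj1 : j ∈ Finset.Icc 1 r := by
    refine Finset.mem_Icc.2 ⟨hj'.1, hj'.2.trans ?_⟩
    rw [rIdx]; split_ifs <;> omega
  have hg := gpt_mem P hi hj1
  have hg' : gpt P r i j ≤ gpt P r i (j + 1) ∧ gpt P r i (j + 1) < b := by
    rcases (Finset.mem_Icc.1 hj1).2.eq_or_lt with rfl | hlt
    · have hN : i ≠ P.N := by
        rintro hN
        rw [rIdx, if_pos hN] at hj'
        omega
      have hi1 : i + 1 ∈ Finset.Icc 1 P.N := Finset.mem_Icc.2 ⟨by omega, by omega⟩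
      have h1 := gpt_mem P (r := j) hi1 (j := 1) (Finset.mem_Icc.2 ⟨le_rfl, hr⟩)
      rw [add_tsub_cancel_right] at h1
      rw [gpt_succ P hr]
      exact ⟨(hg.2.trans h1.1).le, h1.2.trans_le (P.bounds hi1).2.2⟩
    · have hj2 : j + 1 ∈ Finset.Icc 1 r := Finset.mem_Icc.2 ⟨by omega, by omega⟩
      have := node_le P hi (r := r) (j := j) (by omega)
      rw [node_eq_gpt P i hj1, node_eq_gpt P i hj2] at this
      exact ⟨this, (gpt_mem_Ioo P hi hj2).2⟩
  have hga := (gpt_mem_Ioo P hi hj1).1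
  rw [intervalIntegral.integral_of_le hab, intervalIntegral.integral_of_le hg'.1,
    setIntegral_indicator measurableSet_Icc, ← integral_Icc_eq_integral_Ioc]
  congr 2
  ext x
  simp only [Set.mem_inter_iff, Set.mem_Ioc, Set.mem_Icc]
  constructor
  · exact fun h => h.2
  · exact fun h => ⟨⟨hga.trans_le h.1, h.2.trans hg'.2.le⟩, h⟩

/-- The finite volume form, arranged element by element. -/
theorem aP_eq {α β γ v : ℝ → ℝ} {P : Partition a b} {r : ℕ} (hr : 1 ≤ r) (w : ℕ → ℕ → ℝ)
    (hq : ∀ i ∈ Finset.Icc 1 P.N,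
      IntervalIntegrable (fun x => β x * deriv v x + γ x * v x) volume (P.x (i - 1)) (P.x i)) :
    aP α β γ P r v w = ∑ i ∈ Finset.Icc 1 P.N,
      (∑ j ∈ Finset.Icc 1 r, jump P r w i j * α (gpt P r i j) * deriv v (gpt P r i j)
        + ∑ j ∈ Finset.range (r + 1), extCoef P r w i j *
          ∫ x in node P r i j..node P r i (j + 1), (β x * deriv v x + γ x * v x)) := by
  rw [aP, sum_mul_integral_gpt hr w hq, Finset.sum_add_distrib]

/-! ### Coefficients of the differential equation -/

/-- A closed condition that holds almost everywhere holds at the points of continuity. -/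
theorem le_of_continuousAt_of_ae {f : ℝ → ℝ} {m x : ℝ} (hx : x ∈ Set.Ioo a b)
    (hf : ContinuousAt f x) (h : ∀ᵐ y ∂(volume.restrict (Set.Ioo a b)), m ≤ f y) : m ≤ f x := by
  rw [ae_restrict_iff' measurableSet_Ioo] at h
  have hd := Measure.dense_of_ae h
  have hfr := (mem_closure_iff_frequently.1 (hd x)).and_eventually (Ioo_mem_nhds hx.1 hx.2)
  exact ge_of_tendsto_of_frequently hf (hfr.mono fun y hy => hy.1 hy.2)

theorem abs_le_of_continuousAt_of_ae {f : ℝ → ℝ} {M x : ℝ} (hx : x ∈ Set.Ioo a b)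
    (hf : ContinuousAt f x) (h : ∀ᵐ y ∂(volume.restrict (Set.Ioo a b)), |f y| ≤ M) :
    |f x| ≤ M := by
  have := le_of_continuousAt_of_ae hx hf.abs.neg (m := -M) (h.mono fun y hy => neg_le_neg hy)
  exact neg_le_neg_iff.1 this

theorem intervalIntegrable_bdd_mul {c d M : ℝ} (hcd : c ≤ d) {f g : ℝ → ℝ}
    (hm : AEStronglyMeasurable f (volume.restrict (Set.Ioo c d)))
    (hb : ∀ᵐ x ∂(volume.restrict (Set.Ioo c d)), |f x| ≤ M)
    (hg : IntervalIntegrable g volume c d) :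
    IntervalIntegrable (fun x => f x * g x) volume c d := by
  rw [intervalIntegrable_iff_integrableOn_Ioo_of_le hcd] at hg ⊢
  exact Integrable.bdd_mul hg hm (c := M) (by simpa only [Real.norm_eq_abs] using hb)

variable {α₀ κ Λ : ℝ} {α β γ : ℝ → ℝ}

theorem Ioo_subset_of_mem {P : Partition a b} {i : ℕ} (hi : i ∈ Finset.Icc 1 P.N) :
    Set.Ioo (P.x (i - 1)) (P.x i) ⊆ Set.Ioo a b :=
  Set.Ioo_subset_Ioo (P.bounds hi).1 (P.bounds hi).2.2

theorem Admissible.Λ_nonneg (h : Admissible a b α₀ κ Λ α β γ) (hab : a < b) : 0 ≤ Λ := by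
  have := (ae_restrict_iff' measurableSet_Ioo).1 h.bound_α
  obtain ⟨x, hx, hx'⟩ := (Measure.dense_of_ae this).exists_mem_open isOpen_Ioo
    (Set.nonempty_Ioo.2 hab)
  exact (abs_nonneg _).trans (hx hx')

/-! ### Variational exactness -/

/-- The flux of a solution is absolutely continuous, and at points of continuity of `α` it is
given by the classical derivative of the solution. -/
theorem IsSolution.exists_flux (hab : a < b) (hα₀ : 0 < α₀)
    (h : Admissible a b α₀ κ Λ α β γ) {f u : ℝ → ℝ} (hf : IntegrableOn f (Set.Ioo a b))
    (hu : IsSolution a b α β γ f u) :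
    ∃ F : ℝ → ℝ,
      (∀ x ∈ Set.Icc a b, ∀ y ∈ Set.Icc a b,
        F y - F x = ∫ t in x..y, (β t * deriv u t + γ t * u t - f t)) ∧
      ∀ x ∈ Set.Ioo a b, ContinuousAt α x → α x * deriv u x = F x := by
  have hdi : IntervalIntegrable (deriv u) volume a b :=
    intervalIntegrable_of_Ioo hab.le (hu.memH10.memH1.memLp_deriv.integrable one_le_two)
  have hui : IntervalIntegrable u volume a b :=
    intervalIntegrable_of_Ioo hab.le (hu.memH10.memH1.memLp.integrable one_le_two)
  have hq : IntervalIntegrable (fun t => β t * deriv u t + γ t * u t - f t) volume a b :=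
    ((intervalIntegrable_bdd_mul hab.le h.meas_β h.bound_β hdi).add
      (intervalIntegrable_bdd_mul hab.le h.meas_γ h.bound_γ hui)).sub
      (intervalIntegrable_of_Ioo hab.le hf)
  have hαu := intervalIntegrable_bdd_mul hab.le h.meas_α h.bound_α hdi
  obtain ⟨C, hC⟩ := hu.eqn.exists_ae_eq hab
    ((intervalIntegrable_iff_integrableOn_Ioo_of_le hab.le).1 hαu)
    ((intervalIntegrable_iff_integrableOn_Ioo_of_le hab.le).1 hq)
  set F : ℝ → ℝ := fun x => C + ∫ t in a..x, (β t * deriv u t + γ t * u t - f t) with hF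
  have hFc : ContinuousOn F (Set.Icc a b) :=
    IntervalIntegrable.continuousOn_primitive hab.le hq C
  refine ⟨F, fun x hx y hy => ?_, fun x hx hαx => ?_⟩
  · have i₁ := hq.mono_set (uIcc_subset_Icc_of_mem hx)
    have i₂ := hq.mono_set (uIcc_subset_Icc_of_mem hy)
    rw [hF]
    simp only
    rw [add_sub_add_left_eq_sub, intervalIntegral.integral_interval_sub_left i₂ i₁]
  -- Thus `u` is a primitive of `F / α`; this quotient is continuous at `x`, so `u` is
  -- differentiable there with derivative `F x / α x`.
  have hae : ∀ᵐ t, t ∈ Set.Ioo a b → deriv u t = F t / α t := by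
    filter_upwards [hC, (ae_restrict_iff' measurableSet_Ioo).1 h.lower_α] with t h1 h2 ht
    have h3 : α t ≠ 0 := (hα₀.trans_le (h2 ht)).ne'
    rw [eq_div_iff h3, mul_comm]
    exact h1 ht
  have hαx0 : α x ≠ 0 := (hα₀.trans_le (le_of_continuousAt_of_ae hx hαx h.lower_α)).ne'
  have hquot : IntervalIntegrable (fun t => F t / α t) volume a b := by
    refine hdi.congr_ae ?_
    have hne : ∀ᵐ t : ℝ, t ≠ b := by simp [ae_iff, measure_singleton]
    rw [Filter.EventuallyEq, ae_restrict_iff' measurableSet_uIoc]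
    filter_upwards [hae, hne] with t ht htb ht'
    rw [uIoc_of_le hab.le] at ht'
    exact ht ⟨ht'.1, lt_of_le_of_ne ht'.2 htb⟩
  obtain ⟨D, hD⟩ := hu.memH10.memH1.exists_eq hab
  have heq := eqOn_Ioo_of_ae (hu.memH10.cont.mono Set.Ioo_subset_Icc_self)
    ((IntervalIntegrable.continuousOn_primitive hab.le hdi D).mono Set.Ioo_subset_Icc_self) hD
  have hder := hasDerivAt_primitive hquot hx
    ((hFc.continuousAt (Icc_mem_nhds hx.1 hx.2)).div hαx hαx0) D
  have : HasDerivAt u (F x / α x) x := by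
    refine hder.congr_of_eventuallyEq ?_
    filter_upwards [Ioo_mem_nhds hx.1 hx.2] with y hy
    rw [heq hy]
    refine congrArg _ (intervalIntegral.integral_congr_ae ?_)
    filter_upwards [hae] with t ht ht'
    rw [uIoc_of_le hy.1.le] at ht'
    exact ht ⟨ht'.1, ht'.2.trans_lt hy.2⟩
  rw [this.deriv]
  field_simp

/-- The balance of the flux over each piece of a control volume expresses the volume terms minus the
load as flux differences. Summation by parts cancels these against the jump terms, since the flux at
a Gauss point is `α u'`. -/
theorem IsSolution.aP_eq_pairing (hab : a < b) (hα₀ : 0 < α₀)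
    (h : Admissible a b α₀ κ Λ α β γ) {P : Partition a b} {r : ℕ} (hr : 1 ≤ r)
    (hα : ∀ i ∈ Finset.Icc 1 P.N, ∀ j ∈ Finset.Icc 1 r, ContinuousAt α (gpt P r i j))
    {f u : ℝ → ℝ} (hf : IntegrableOn f (Set.Ioo a b))
    (hu : IsSolution a b α β γ f u) (w : ℕ → ℕ → ℝ) : aP α β γ P r u w = pairing f P r w := by
  obtain ⟨F, hF, hFα⟩ := hu.exists_flux hab hα₀ h hf
  have hdi : IntervalIntegrable (deriv u) volume a b :=
    intervalIntegrable_of_Ioo hab.le (hu.memH10.memH1.memLp_deriv.integrable one_le_two)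
  have hui : IntervalIntegrable u volume a b :=
    intervalIntegrable_of_Ioo hab.le (hu.memH10.memH1.memLp.integrable one_le_two)
  have hfi := intervalIntegrable_of_Ioo hab.le hf
  have hq : IntervalIntegrable (fun t => β t * deriv u t + γ t * u t) volume a b :=
    (intervalIntegrable_bdd_mul hab.le h.meas_β h.bound_β hdi).add
      (intervalIntegrable_bdd_mul hab.le h.meas_γ h.bound_γ hui)
  have hmono : ∀ {q : ℝ → ℝ}, IntervalIntegrable q volume a b → ∀ i ∈ Finset.Icc 1 P.N,
      IntervalIntegrable q volume (P.x (i - 1)) (P.x i) := by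
    intro q hq i hi
    have := P.bounds hi
    refine hq.mono_set ?_
    rw [uIcc_of_le this.2.1.le, uIcc_of_le hab.le]
    exact Set.Icc_subset_Icc this.1 this.2.2
  -- The claim becomes "difference equals zero", and this zero is replaced by the summation-by-parts
  -- identity for `F`; the two sides are then compared term by term.
  rw [pairing_eq hr w hfi, sum_mul_integral_gpt hr w (hmono hfi), aP_eq hr w (hmono hq),
    ← sub_eq_zero, ← sum_jump_mul_add_sum_extCoef_mul hr w F (P := P), Finset.sum_add_distrib,
    add_sub_assoc, ← Finset.sum_sub_distrib]
  congr 1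
  · refine Finset.sum_congr rfl fun i hi => Finset.sum_congr rfl fun j hj => ?_
    rw [mul_assoc, hFα _ (gpt_mem_Ioo P hi hj) (hα i hi j hj)]
  · refine Finset.sum_congr rfl fun i hi => ?_
    rw [← Finset.sum_sub_distrib]
    refine Finset.sum_congr rfl fun j hj => ?_
    have hj' := Finset.mem_range.1 hj
    have hsub : Set.Icc (P.x (i - 1)) (P.x i) ⊆ Set.Icc a b :=
      Set.Icc_subset_Icc (P.bounds hi).1 (P.bounds hi).2.2
    rw [hF _ (hsub (node_mem P hi (by omega))) _ (hsub (node_mem P hi (by omega))), ← mul_sub,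
      ← intervalIntegral.integral_sub]
    · exact intervalIntegrable_node hi (hmono hq i hi) (by omega) (by omega)
    · exact intervalIntegrable_node hi (hmono hfi i hi) (by omega) (by omega)

/-! ### Piecewise `H²` functions -/

/-- The square of the contribution of `(c, d)` to the norm `‖v‖_P`. -/
noncomputable def elemSq (c d : ℝ) (v : ℝ → ℝ) : ℝ :=
  (∫ x in Set.Ioo c d, v x ^ 2) + (∫ x in Set.Ioo c d, deriv v x ^ 2)
    + (d - c) ^ 2 * ∫ x in Set.Ioo c d, deriv (deriv v) x ^ 2

theorem elemSq_nonneg (c d : ℝ) (v : ℝ → ℝ) : 0 ≤ elemSq c d v := by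
  unfold elemSq
  have h : ∀ f : ℝ → ℝ, 0 ≤ ∫ x in Set.Ioo c d, f x ^ 2 := fun f =>
    integral_nonneg fun _ => sq_nonneg _
  have := h v
  have := h (deriv v)
  have := mul_nonneg (sq_nonneg (d - c)) (h (deriv (deriv v)))
  linarith

theorem normP_nonneg (P : Partition a b) (v : ℝ → ℝ) : 0 ≤ normP P v := Real.sqrt_nonneg _

theorem sq_normP (P : Partition a b) (v : ℝ → ℝ) :
    normP P v ^ 2 = ∑ i ∈ Finset.Icc 1 P.N, elemSq (P.x (i - 1)) (P.x i) v :=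
  Real.sq_sqrt (Finset.sum_nonneg fun _ _ => elemSq_nonneg _ _ _)

theorem normP'_nonneg (P : Partition a b) (r : ℕ) (w : ℕ → ℕ → ℝ) : 0 ≤ normP' P r w :=
  Real.sqrt_nonneg _

theorem sq_normP' (P : Partition a b) (r : ℕ) (w : ℕ → ℕ → ℝ) :
    normP' P r w ^ 2 =
      (∑ i ∈ Finset.Icc 1 P.N, ∑ j ∈ Finset.Icc 1 r, (P.h i)⁻¹ * jump P r w i j ^ 2)
      + ∑ i ∈ Finset.Icc 1 P.N, ∑ j ∈ Finset.Icc 1 (rIdx P r i), P.h i * w i j ^ 2 := by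
  refine Real.sq_sqrt (add_nonneg ?_ ?_) <;>
    refine Finset.sum_nonneg fun i hi => Finset.sum_nonneg fun j _ => ?_
  · exact mul_nonneg (inv_nonneg.2 (P.h_pos hi).le) (sq_nonneg _)
  · exact mul_nonneg (P.h_pos hi).le (sq_nonneg _)

/-- On every element, `v` is continuously differentiable with an absolutely continuous derivative
whose derivative is square integrable. -/
def IsPiecewiseH2 (P : Partition a b) (v : ℝ → ℝ) : Prop :=
  ∀ i ∈ Finset.Icc 1 P.N, ∃ G g, HasH2Data (P.x (i - 1)) (P.x i) v G g

theorem MemBrokenH2.isPiecewiseH2 {P : Partition a b} {v : ℝ → ℝ} (h : MemBrokenH2 P v) :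
    IsPiecewiseH2 P v := fun i hi =>
  (h.2 i hi).exists_hasH2Data (P.lt i hi)
    (h.1.mono (Set.Icc_subset_Icc (P.bounds hi).1 (P.bounds hi).2.2))

theorem isPiecewiseH2_of_mem_trialSpace {P : Partition a b} {r : ℕ} {v : ℝ → ℝ}
    (h : v ∈ trialSpace P r) : IsPiecewiseH2 P v := fun i hi => by
  obtain ⟨p, _, hp⟩ := h.2.1 i hi
  exact ⟨_, _, hasH2Data_of_polynomial hp⟩

theorem IsPiecewiseH2.lin {P : Partition a b} {v₁ v₂ : ℝ → ℝ} (h₁ : IsPiecewiseH2 P v₁)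
    (h₂ : IsPiecewiseH2 P v₂) (s t : ℝ) : IsPiecewiseH2 P (fun x => s * v₁ x + t * v₂ x) := by
  intro i hi
  obtain ⟨G₁, g₁, d₁⟩ := h₁ i hi
  obtain ⟨G₂, g₂, d₂⟩ := h₂ i hi
  exact ⟨_, _, d₁.lin d₂ (P.lt i hi) s t⟩

namespace HasH2Data

variable {c d : ℝ} {v G g : ℝ → ℝ}

theorem elemSq_eq (h : HasH2Data c d v G g) (hcd : c < d) :
    elemSq c d v = (∫ x in c..d, v x ^ 2) + (∫ x in c..d, G x ^ 2)
      + (d - c) ^ 2 * ∫ x in c..d, g x ^ 2 := by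
  rw [elemSq, h.integral_sq_deriv hcd, h.integral_sq_deriv_deriv hcd, setIntegral_Ioo_eq hcd.le]

theorem intervalIntegrable_deriv (h : HasH2Data c d v G g) (hcd : c < d) :
    IntervalIntegrable (deriv v) volume c d := by
  have hG : IntervalIntegrable G volume c d := by
    apply ContinuousOn.intervalIntegrable
    rw [uIcc_of_le hcd.le]
    exact h.continuousOn_deriv hcd
  rw [intervalIntegrable_iff_integrableOn_Ioo_of_le hcd.le] at hG ⊢
  exact hG.congr_fun (fun x hx => (h.deriv_eq hx).symm) measurableSet_Ioo

theorem intervalIntegrable_self (h : HasH2Data c d v G g) (hcd : c < d) :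
    IntervalIntegrable v volume c d := by
  apply ContinuousOn.intervalIntegrable
  rw [uIcc_of_le hcd.le]
  exact h.cont

theorem memLp_deriv (h : HasH2Data c d v G g) (hcd : c < d) :
    MemLp (deriv v) 2 (volume.restrict (Set.Ioo c d)) :=
  (memLp_two_of_continuousOn (h.continuousOn_deriv hcd)).ae_eq
    ((ae_restrict_iff' measurableSet_Ioo).2
      (Filter.Eventually.of_forall fun _ hx => (h.deriv_eq hx).symm))

/-- Point values of the derivative are bounded by the local energy. -/
theorem mul_sq_deriv_le (h : HasH2Data c d v G g) (hcd : c < d) {x : ℝ} (hx : x ∈ Set.Ioo c d) :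
    (d - c) * deriv v x ^ 2 ≤ 2 * elemSq c d v := by
  rw [h.deriv_eq hx, h.elemSq_eq hcd]
  have h1 := h.sq_deriv_le hcd (Set.Ioo_subset_Icc_self hx)
  have h2 : 0 ≤ ∫ x in c..d, v x ^ 2 :=
    intervalIntegral.integral_nonneg hcd.le fun _ _ => sq_nonneg _
  linarith

end HasH2Data

/-- The lower order terms are integrable on every element. -/
theorem Admissible.intervalIntegrable (h : Admissible a b α₀ κ Λ α β γ) {P : Partition a b}
    {v : ℝ → ℝ} (hv : IsPiecewiseH2 P v) {i : ℕ} (hi : i ∈ Finset.Icc 1 P.N) :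
    IntervalIntegrable (fun x => β x * deriv v x + γ x * v x) volume (P.x (i - 1)) (P.x i) := by
  obtain ⟨G, g, d⟩ := hv i hi
  have hlt := P.lt i hi
  have hle : volume.restrict (Set.Ioo (P.x (i - 1)) (P.x i)) ≤ volume.restrict (Set.Ioo a b) :=
    Measure.restrict_mono (Ioo_subset_of_mem hi) le_rfl
  exact (intervalIntegrable_bdd_mul hlt.le (h.meas_β.mono_measure hle)
      (ae_mono hle h.bound_β) (d.intervalIntegrable_deriv hlt)).add
    (intervalIntegrable_bdd_mul hlt.le (h.meas_γ.mono_measure hle)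
      (ae_mono hle h.bound_γ) (d.intervalIntegrable_self hlt))

/-- An `L¹` bound for the lower order terms on an element. -/
theorem Admissible.integral_abs_le (h : Admissible a b α₀ κ Λ α β γ) {P : Partition a b}
    {v : ℝ → ℝ} (hv : IsPiecewiseH2 P v) {i : ℕ} (hi : i ∈ Finset.Icc 1 P.N) :
    ∫ x in P.x (i - 1)..P.x i, |β x * deriv v x + γ x * v x| ≤
      Λ * ((∫ x in P.x (i - 1)..P.x i, |deriv v x|) + ∫ x in P.x (i - 1)..P.x i, |v x|) := by
  obtain ⟨G, g, d⟩ := hv i hi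
  have hlt := P.lt i hi
  have id := (d.intervalIntegrable_deriv hlt).abs
  have iv := (d.intervalIntegrable_self hlt).abs
  rw [← intervalIntegral.integral_add id iv, ← intervalIntegral.integral_const_mul]
  refine intervalIntegral.integral_mono_ae_restrict hlt.le (h.intervalIntegrable hv hi).abs
    ((id.add iv).const_mul Λ) ?_
  have hle : ∀ {p : ℝ → Prop}, (∀ᵐ x ∂(volume.restrict (Set.Ioo a b)), p x) →
      ∀ᵐ x ∂(volume.restrict (Set.Icc (P.x (i - 1)) (P.x i))), p x := by
    intro p hp
    rw [restrict_Ioo_eq_restrict_Icc] at hp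
    exact ae_mono (Measure.restrict_mono
      (Set.Icc_subset_Icc (P.bounds hi).1 (P.bounds hi).2.2) le_rfl) hp
  filter_upwards [hle h.bound_β, hle h.bound_γ] with x h1 h2
  calc |β x * deriv v x + γ x * v x| ≤ |β x| * |deriv v x| + |γ x| * |v x| := by
        rw [← abs_mul, ← abs_mul]; exact abs_add_le _ _
    _ ≤ Λ * |deriv v x| + Λ * |v x| := by gcongr
    _ = Λ * (|deriv v x| + |v x|) := by ring

theorem Admissible.sq_integral_abs_le (h : Admissible a b α₀ κ Λ α β γ)
    {P : Partition a b} {v : ℝ → ℝ} (hv : IsPiecewiseH2 P v) {i : ℕ}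
    (hi : i ∈ Finset.Icc 1 P.N) :
    (∫ x in P.x (i - 1)..P.x i, |β x * deriv v x + γ x * v x|) ^ 2 ≤
      2 * Λ ^ 2 * P.h i * ((∫ x in Set.Ioo (P.x (i - 1)) (P.x i), v x ^ 2)
        + ∫ x in Set.Ioo (P.x (i - 1)) (P.x i), deriv v x ^ 2) := by
  obtain ⟨G, g, d⟩ := hv i hi
  have hlt := P.lt i hi
  have h0 : 0 ≤ ∫ x in P.x (i - 1)..P.x i, |β x * deriv v x + γ x * v x| :=
    intervalIntegral.integral_nonneg hlt.le fun _ _ => abs_nonneg _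
  have h1 := pow_le_pow_left₀ h0 (h.integral_abs_le hv hi) 2
  have h2 := FVM.sq_integral_abs_le hlt (d.memLp_deriv hlt)
  have h3 := FVM.sq_integral_abs_le hlt (memLp_two_of_continuousOn d.cont)
  rw [setIntegral_Ioo_eq hlt.le, setIntegral_Ioo_eq hlt.le, Partition.h]
  refine h1.trans ?_
  set A := ∫ x in P.x (i - 1)..P.x i, |deriv v x|
  set B := ∫ x in P.x (i - 1)..P.x i, |v x|
  have h4 : (A + B) ^ 2 ≤ 2 * (P.x i - P.x (i - 1)) * ((∫ x in P.x (i - 1)..P.x i, v x ^ 2)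
      + ∫ x in P.x (i - 1)..P.x i, deriv v x ^ 2) := by nlinarith [sq_nonneg (A - B)]
  have := mul_le_mul_of_nonneg_left h4 (sq_nonneg Λ)
  nlinarith

/-! ### Boundedness -/

theorem sum_extCoef_eq {P : Partition a b} {r i : ℕ} (w : ℕ → ℕ → ℝ) (hr : 1 ≤ r) :
    ∑ j ∈ Finset.Icc 1 r, extCoef P r w i j ^ 2 = ∑ j ∈ Finset.Icc 1 (rIdx P r i), w i j ^ 2 := by
  have h1 : ∑ j ∈ Finset.Icc 1 (rIdx P r i), w i j ^ 2
      = ∑ j ∈ Finset.Icc 1 (rIdx P r i), extCoef P r w i j ^ 2 :=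
    Finset.sum_congr rfl fun j hj => by rw [extCoef_eq P w hj]
  rw [h1, rIdx]
  split_ifs with hN
  · obtain ⟨s, rfl⟩ : ∃ s, r = s + 1 := ⟨r - 1, by omega⟩
    rw [Finset.sum_Icc_succ_top (by omega), hN, extCoef_last, add_tsub_cancel_right]
    ring
  · rfl

/-- The coefficient with `j = 0` belongs to the previous element, but it is the one with `j = 1`
minus a jump inside `τ_i`, so the element's own share of the norm controls it. Trading `h_i` for
`h_i⁻¹` in front of the jumps costs `(b - a)²`. -/
theorem sum_extCoef_sq_le {P : Partition a b} {r i : ℕ} (w : ℕ → ℕ → ℝ) (hr : 1 ≤ r)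
    (hi : i ∈ Finset.Icc 1 P.N) :
    ∑ j ∈ Finset.range (r + 1), P.h i * extCoef P r w i j ^ 2 ≤
      (3 + 2 * (b - a) ^ 2) * ((∑ j ∈ Finset.Icc 1 r, (P.h i)⁻¹ * jump P r w i j ^ 2)
        + ∑ j ∈ Finset.Icc 1 (rIdx P r i), P.h i * w i j ^ 2) := by
  have hh := P.h_pos hi
  have hone : 1 ∈ Finset.Icc 1 r := Finset.mem_Icc.2 ⟨le_rfl, hr⟩
  rw [Finset.sum_range_succ', ← sum_Icc_one_eq_sum_range
    (fun j => P.h i * extCoef P r w i j ^ 2), ← Finset.mul_sum, ← Finset.mul_sum,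
    ← Finset.mul_sum, sum_extCoef_eq w hr]
  set B := ∑ j ∈ Finset.Icc 1 (rIdx P r i), w i j ^ 2 with hB
  set A := ∑ j ∈ Finset.Icc 1 r, jump P r w i j ^ 2 with hA
  have h1 : extCoef P r w i 1 ^ 2 ≤ B := by
    rw [hB, ← sum_extCoef_eq w hr]
    exact Finset.single_le_sum (f := fun j => extCoef P r w i j ^ 2)
      (fun j _ => sq_nonneg _) hone
  have h2 : jump P r w i 1 ^ 2 ≤ A :=
    Finset.single_le_sum (f := fun j => jump P r w i j ^ 2) (fun j _ => sq_nonneg _) hone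
  have h3 : extCoef P r w i 0 ^ 2 ≤ 2 * B + 2 * A := by
    have : jump P r w i 1 = extCoef P r w i 1 - extCoef P r w i 0 := by rw [jump]
    rw [this] at h2
    nlinarith [sq_nonneg (2 * extCoef P r w i 1 - extCoef P r w i 0)]
  have hA0 : 0 ≤ A := Finset.sum_nonneg fun _ _ => sq_nonneg _
  have hB0 : 0 ≤ B := Finset.sum_nonneg fun _ _ => sq_nonneg _
  have h4 : P.h i * A ≤ (b - a) ^ 2 * ((P.h i)⁻¹ * A) := by
    have : P.h i * A = P.h i ^ 2 * ((P.h i)⁻¹ * A) := by field_simp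
    rw [this]
    exact mul_le_mul_of_nonneg_right (pow_le_pow_left₀ hh.le (P.h_le hi) 2) (by positivity)
  have h5 := mul_le_mul_of_nonneg_left h3 hh.le
  have h6 : 0 ≤ (P.h i)⁻¹ * A := by positivity
  have h7 : 0 ≤ (b - a) ^ 2 * (P.h i * B) := by positivity
  nlinarith

/-- The bound for the finite volume form up to the factor `Λ`. -/
noncomputable def boundConst (r : ℕ) (a b : ℝ) : ℝ :=
  2 * Real.sqrt (2 * (r + 1) * (3 + 2 * (b - a) ^ 2))

theorem boundConst_nonneg (r : ℕ) (a b : ℝ) : 0 ≤ boundConst r a b := by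
  unfold boundConst; positivity

theorem sum_sum_sq_le_mul {s t : Finset ℕ} {f g h : ℕ → ℕ → ℝ}
    (hg : ∀ i ∈ s, ∀ j ∈ t, 0 ≤ g i j) (hh : ∀ i ∈ s, ∀ j ∈ t, 0 ≤ h i j)
    (hf : ∀ i ∈ s, ∀ j ∈ t, f i j ^ 2 ≤ g i j * h i j) :
    (∑ i ∈ s, ∑ j ∈ t, f i j) ^ 2 ≤ (∑ i ∈ s, ∑ j ∈ t, g i j) * ∑ i ∈ s, ∑ j ∈ t, h i j := by
  rw [← Finset.sum_product', ← Finset.sum_product', ← Finset.sum_product']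
  refine Finset.sum_sq_le_sum_mul_sum_of_sq_le_mul _ ?_ ?_ ?_ <;> intro x hx <;>
    rw [Finset.mem_product] at hx
  · exact hg _ hx.1 _ hx.2
  · exact hh _ hx.1 _ hx.2
  · exact hf _ hx.1 _ hx.2

/-- Weighted Cauchy-Schwarz in both sums. Jumps with weight `h_i⁻¹` meet `h_i α² (v')²` at Gauss
points, which the local energy bounds; coefficients with weight `h_i` meet integrals whose squares
are `O(h_i)` times the local `H¹` energy. Only piecewise regularity of `v` enters, so the bound also
applies to combinations of solutions and trial functions. -/
theorem Admissible.abs_aP_le (hab : a < b) (h : Admissible a b α₀ κ Λ α β γ) {P : Partition a b}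
    {r : ℕ} (hr : 1 ≤ r)
    (hα : ∀ i ∈ Finset.Icc 1 P.N, ∀ j ∈ Finset.Icc 1 r, ContinuousAt α (gpt P r i j))
    {v : ℝ → ℝ} (hv : IsPiecewiseH2 P v) (w : ℕ → ℕ → ℝ) :
    |aP α β γ P r v w| ≤ boundConst r a b * Λ * normP P v * normP' P r w := by
  have hΛ := h.Λ_nonneg hab
  rw [aP_eq hr w fun i hi => h.intervalIntegrable hv hi, Finset.sum_add_distrib]
  set A₁ := ∑ i ∈ Finset.Icc 1 P.N, ∑ j ∈ Finset.Icc 1 r,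
    jump P r w i j * α (gpt P r i j) * deriv v (gpt P r i j) with hA₁
  set A₂ := ∑ i ∈ Finset.Icc 1 P.N, ∑ j ∈ Finset.range (r + 1), extCoef P r w i j *
    ∫ x in node P r i j..node P r i (j + 1), (β x * deriv v x + γ x * v x) with hA₂
  set V := normP P v ^ 2 with hV
  set W := normP' P r w ^ 2 with hW
  set L := 3 + 2 * (b - a) ^ 2 with hL
  have hW' := sq_normP' P r w
  have hV' := sq_normP P v
  have hV0 : 0 ≤ V := sq_nonneg _
  have hW0 : 0 ≤ W := sq_nonneg _
  have hL1 : 1 ≤ L := by rw [hL]; nlinarith [sq_nonneg (b - a)]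
  have hrnn : (0 : ℝ) ≤ r := Nat.cast_nonneg r
  have h₁ : A₁ ^ 2 ≤ 2 * r * Λ ^ 2 * (W * V) := by
    have hcs : A₁ ^ 2 ≤
        (∑ i ∈ Finset.Icc 1 P.N, ∑ j ∈ Finset.Icc 1 r, (P.h i)⁻¹ * jump P r w i j ^ 2) *
        ∑ i ∈ Finset.Icc 1 P.N, ∑ j ∈ Finset.Icc 1 r,
          2 * Λ ^ 2 * elemSq (P.x (i - 1)) (P.x i) v := by
      refine sum_sum_sq_le_mul (fun i hi j _ => ?_) (fun i _ j _ => ?_) fun i hi j hj => ?_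
      · exact mul_nonneg (inv_nonneg.2 (P.h_pos hi).le) (sq_nonneg _)
      · exact mul_nonneg (by positivity) (elemSq_nonneg _ _ _)
      · obtain ⟨G, g, d⟩ := hv i hi
        have hh := P.h_pos hi
        have e1 := d.mul_sq_deriv_le (P.lt i hi) (gpt_mem P hi hj)
        have e2 := abs_le_of_continuousAt_of_ae (gpt_mem_Ioo P hi hj) (hα i hi j hj) h.bound_α
        have e3 : α (gpt P r i j) ^ 2 ≤ Λ ^ 2 := sq_le_sq' (abs_le.1 e2).1 (abs_le.1 e2).2
        have e4 : P.h i * (α (gpt P r i j) ^ 2 * deriv v (gpt P r i j) ^ 2)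
            ≤ 2 * Λ ^ 2 * elemSq (P.x (i - 1)) (P.x i) v := by
          calc P.h i * (α (gpt P r i j) ^ 2 * deriv v (gpt P r i j) ^ 2)
              = α (gpt P r i j) ^ 2 * (P.h i * deriv v (gpt P r i j) ^ 2) := by ring
            _ ≤ Λ ^ 2 * (2 * elemSq (P.x (i - 1)) (P.x i) v) :=
                mul_le_mul e3 e1 (by positivity) (by positivity)
            _ = _ := by ring
        calc (jump P r w i j * α (gpt P r i j) * deriv v (gpt P r i j)) ^ 2
            = ((P.h i)⁻¹ * jump P r w i j ^ 2) *
              (P.h i * (α (gpt P r i j) ^ 2 * deriv v (gpt P r i j) ^ 2)) := by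
                field_simp
          _ ≤ _ := mul_le_mul_of_nonneg_left e4
                (mul_nonneg (inv_nonneg.2 hh.le) (sq_nonneg _))
    have hs : ∑ i ∈ Finset.Icc 1 P.N, ∑ j ∈ Finset.Icc 1 r,
        2 * Λ ^ 2 * elemSq (P.x (i - 1)) (P.x i) v = 2 * r * Λ ^ 2 * V := by
      rw [hV, hV', Finset.mul_sum]
      refine Finset.sum_congr rfl fun i _ => ?_
      rw [Finset.sum_const, Nat.card_Icc, nsmul_eq_mul, add_tsub_cancel_right]
      ring
    rw [hs] at hcs
    refine hcs.trans ?_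
    rw [show 2 * r * Λ ^ 2 * (W * V) = W * (2 * r * Λ ^ 2 * V) by ring]
    refine mul_le_mul_of_nonneg_right ?_ (by positivity)
    rw [hW, hW']
    refine le_add_of_nonneg_right (Finset.sum_nonneg fun i hi => Finset.sum_nonneg fun j _ => ?_)
    exact mul_nonneg (P.h_pos hi).le (sq_nonneg _)
  have h₂ : A₂ ^ 2 ≤ 2 * (r + 1) * L * Λ ^ 2 * (W * V) := by
    have hcs : A₂ ^ 2 ≤
        (∑ i ∈ Finset.Icc 1 P.N, ∑ j ∈ Finset.range (r + 1), P.h i * extCoef P r w i j ^ 2) *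
        ∑ i ∈ Finset.Icc 1 P.N, ∑ j ∈ Finset.range (r + 1),
          2 * Λ ^ 2 * elemSq (P.x (i - 1)) (P.x i) v := by
      refine sum_sum_sq_le_mul (fun i hi j _ => ?_) (fun i _ j _ => ?_) fun i hi j hj => ?_
      · exact mul_nonneg (P.h_pos hi).le (sq_nonneg _)
      · exact mul_nonneg (by positivity) (elemSq_nonneg _ _ _)
      · have hj' := Finset.mem_range.1 hj
        have hh := P.h_pos hi
        have e1 := abs_integral_le_integral_abs (h.intervalIntegrable hv hi)
          (node_mem P hi (r := r) (j := j) (by omega)).1 (node_le P hi (by omega))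
          (node_mem P hi (r := r) (j := j + 1) (by omega)).2
        have e2 := h.sq_integral_abs_le hv hi
        set I := ∫ x in node P r i j..node P r i (j + 1), (β x * deriv v x + γ x * v x)
        have e3 : I ^ 2 ≤ P.h i * (2 * Λ ^ 2 * elemSq (P.x (i - 1)) (P.x i) v) := by
          have e4 : I ^ 2 ≤ (∫ x in P.x (i - 1)..P.x i, |β x * deriv v x + γ x * v x|) ^ 2 :=
            sq_le_sq' (abs_le.1 e1).1 (abs_le.1 e1).2
          have e5 : (∫ x in Set.Ioo (P.x (i - 1)) (P.x i), v x ^ 2)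
              + (∫ x in Set.Ioo (P.x (i - 1)) (P.x i), deriv v x ^ 2)
              ≤ elemSq (P.x (i - 1)) (P.x i) v := by
            rw [elemSq]
            exact le_add_of_nonneg_right (mul_nonneg (sq_nonneg _)
              (integral_nonneg fun _ => sq_nonneg _))
          have := mul_le_mul_of_nonneg_left e5 (show 0 ≤ 2 * Λ ^ 2 * P.h i by positivity)
          linarith
        calc (extCoef P r w i j * I) ^ 2 = extCoef P r w i j ^ 2 * I ^ 2 := by ring
          _ ≤ extCoef P r w i j ^ 2 * (P.h i * (2 * Λ ^ 2 * elemSq (P.x (i - 1)) (P.x i) v)) :=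
              mul_le_mul_of_nonneg_left e3 (sq_nonneg _)
          _ = _ := by ring
    have hs : ∑ i ∈ Finset.Icc 1 P.N, ∑ j ∈ Finset.range (r + 1),
        2 * Λ ^ 2 * elemSq (P.x (i - 1)) (P.x i) v = 2 * (r + 1) * Λ ^ 2 * V := by
      rw [hV, hV', Finset.mul_sum]
      refine Finset.sum_congr rfl fun i _ => ?_
      rw [Finset.sum_const, Finset.card_range, nsmul_eq_mul]
      push_cast
      ring
    rw [hs] at hcs
    refine hcs.trans ?_
    rw [show 2 * (r + 1) * L * Λ ^ 2 * (W * V) = (L * W) * (2 * (r + 1) * Λ ^ 2 * V) by ring]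
    refine mul_le_mul_of_nonneg_right ?_ (by positivity)
    rw [hW, hW', ← Finset.sum_add_distrib, Finset.mul_sum]
    exact Finset.sum_le_sum fun i hi => sum_extCoef_sq_le w hr hi
  set K := 2 * (r + 1) * L with hK
  have hK0 : 0 ≤ K := by positivity
  have h₃ : A₁ ^ 2 ≤ K * Λ ^ 2 * (W * V) := by
    refine h₁.trans (mul_le_mul_of_nonneg_right (mul_le_mul_of_nonneg_right ?_ (sq_nonneg _))
      (by positivity))
    rw [hK]; nlinarith
  -- Both squares are at most `K Λ² W V`, and `(A₁ + A₂)² ≤ 2 A₁² + 2 A₂²`; this is the origin of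
  -- the factor 2 in `boundConst`.
  have hsum : (A₁ + A₂) ^ 2 ≤ (boundConst r a b * Λ * normP P v * normP' P r w) ^ 2 := by
    have : (boundConst r a b * Λ * normP P v * normP' P r w) ^ 2
        = 4 * (K * Λ ^ 2 * (W * V)) := by
      rw [boundConst, mul_pow, mul_pow, mul_pow, mul_pow, Real.sq_sqrt hK0]
      ring
    rw [this]
    nlinarith [sq_nonneg (A₁ - A₂)]
  refine abs_le_of_sq_le_sq hsum ?_
  have := boundConst_nonneg r a b
  have := normP_nonneg P v
  have := normP'_nonneg P r w
  positivity

/-! ### The test function belonging to a trial function -/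

/-- The square of the `H¹` norm on `(c, d)`. -/
noncomputable def h1Sq (c d : ℝ) (v : ℝ → ℝ) : ℝ :=
  (∫ x in Set.Ioo c d, v x ^ 2) + ∫ x in Set.Ioo c d, deriv v x ^ 2

theorem h1Sq_nonneg (c d : ℝ) (v : ℝ → ℝ) : 0 ≤ h1Sq c d v :=
  add_nonneg (integral_nonneg fun _ => sq_nonneg _) (integral_nonneg fun _ => sq_nonneg _)

theorem integral_sq_deriv_le_h1Sq (c d : ℝ) (v : ℝ → ℝ) :
    ∫ x in Set.Ioo c d, deriv v x ^ 2 ≤ h1Sq c d v :=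
  le_add_of_nonneg_left (integral_nonneg fun _ => sq_nonneg _)

theorem degree_derivative_lt_of_natDegree_le {r : ℕ} (hr : 1 ≤ r) {p : ℝ[X]}
    (hp : p.natDegree ≤ r) : (derivative p).degree < r := by
  refine degree_le_natDegree.trans_lt ?_
  have := natDegree_derivative_le p
  exact_mod_cast (show (derivative p).natDegree < r by omega)

/-- The inverse inequality for `p'`, of degree below `r`, absorbs the second derivative, with a
constant independent of the interval. -/
theorem elemSq_le {r : ℕ} (hr : 1 ≤ r) {c d : ℝ} (hcd : c < d) {v : ℝ → ℝ} {p : ℝ[X]}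
    (hp : p.natDegree ≤ r) (hv : ∀ x ∈ Set.Icc c d, v x = p.eval x) :
    elemSq c d v ≤ (1 + inverseConst r) * h1Sq c d v := by
  have hd := hasH2Data_of_polynomial hv
  have h1 := inverse_inequality hcd (degree_derivative_lt_of_natDegree_le hr hp)
  rw [hd.elemSq_eq hcd, h1Sq, hd.integral_sq_deriv hcd, setIntegral_Ioo_eq hcd.le]
  have h2 : 0 ≤ ∫ x in c..d, v x ^ 2 :=
    intervalIntegral.integral_nonneg hcd.le fun _ _ => sq_nonneg _
  nlinarith [mul_nonneg (inverseConst_nonneg r) h2]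

/-- The weights of the Gauss quadrature formula on `τ_i`. -/
noncomputable def elemWeight (P : Partition a b) (r i j : ℕ) : ℝ := P.h i / 2 * gaussWeight r j

theorem elemWeight_pos {P : Partition a b} {r i j : ℕ} (hi : i ∈ Finset.Icc 1 P.N)
    (hj : j ∈ Finset.Icc 1 r) : 0 < elemWeight P r i j :=
  mul_pos (half_pos (P.h_pos hi)) (gaussWeight_pos hj)

theorem sum_elemWeight (P : Partition a b) {r : ℕ} (hr : 1 ≤ r) (i : ℕ) :
    ∑ j ∈ Finset.Icc 1 r, elemWeight P r i j = P.h i := by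
  simp only [elemWeight]
  rw [← Finset.mul_sum, sum_gaussWeight hr]
  ring

theorem elemWeight_le {P : Partition a b} {r i j : ℕ} (hr : 1 ≤ r) (hi : i ∈ Finset.Icc 1 P.N)
    (hj : j ∈ Finset.Icc 1 r) : elemWeight P r i j ≤ P.h i := by
  rw [← sum_elemWeight P hr i]
  exact Finset.single_le_sum (f := fun j => elemWeight P r i j)
    (fun j hj => (elemWeight_pos hi hj).le) hj

theorem integral_eq_sum_elemWeight {P : Partition a b} {r i : ℕ} (hi : i ∈ Finset.Icc 1 P.N)
    {q : ℝ[X]} (hq : q.degree < (2 * r : ℕ)) :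
    ∫ x in P.x (i - 1)..P.x i, q.eval x
      = ∑ j ∈ Finset.Icc 1 r, elemWeight P r i j * q.eval (gpt P r i j) := by
  rw [integral_eq_gauss (P.lt i hi) hq]
  refine Finset.sum_congr rfl fun j hj => ?_
  rw [gpt_eq P i (Finset.mem_Icc.1 hj).2, elemWeight, Partition.h]

theorem deriv_gpt_eq {P : Partition a b} {r i j : ℕ} (hi : i ∈ Finset.Icc 1 P.N)
    (hj : j ∈ Finset.Icc 1 r) {v : ℝ → ℝ} {p : ℝ[X]}
    (hv : ∀ x ∈ Set.Icc (P.x (i - 1)) (P.x i), v x = p.eval x) :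
    deriv v (gpt P r i j) = (derivative p).eval (gpt P r i j) :=
  (hasH2Data_of_polynomial hv).deriv_eq (gpt_mem P hi hj)

theorem integral_sq_deriv_eq_sum {P : Partition a b} {r i : ℕ} (hr : 1 ≤ r)
    (hi : i ∈ Finset.Icc 1 P.N) {v : ℝ → ℝ} {p : ℝ[X]} (hp : p.natDegree ≤ r)
    (hv : ∀ x ∈ Set.Icc (P.x (i - 1)) (P.x i), v x = p.eval x) :
    ∫ x in Set.Ioo (P.x (i - 1)) (P.x i), deriv v x ^ 2
      = ∑ j ∈ Finset.Icc 1 r, elemWeight P r i j * deriv v (gpt P r i j) ^ 2 := by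
  have hdeg : (derivative p ^ 2).degree < (2 * r : ℕ) := by
    refine degree_le_natDegree.trans_lt ?_
    have h1 := natDegree_derivative_le p
    have h2 : (derivative p ^ 2).natDegree ≤ 2 * (derivative p).natDegree := natDegree_pow_le
    exact_mod_cast (show (derivative p ^ 2).natDegree < 2 * r by omega)
  have := integral_eq_sum_elemWeight hi hdeg
  simp only [eval_pow] at this
  rw [(hasH2Data_of_polynomial hv).integral_sq_deriv (P.lt i hi), this]
  exact Finset.sum_congr rfl fun j hj => by rw [deriv_gpt_eq hi hj hv]

/-- The coefficients of the test function whose jumps are the weighted values of `v'` at the Gauss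
points. -/
noncomputable def dualCoef (P : Partition a b) (r : ℕ) (v : ℝ → ℝ) (i j : ℕ) : ℝ :=
  v (P.x (i - 1)) + ∑ k ∈ Finset.Icc 1 j, elemWeight P r i k * deriv v (gpt P r i k)

/-- The full sum of jumps is the Gauss quadrature of `v'` over `τ_i`, which is exact. -/
theorem dualCoef_last {P : Partition a b} {r : ℕ} (hr : 1 ≤ r) {v : ℝ → ℝ}
    (hv : v ∈ trialSpace P r) {i : ℕ} (hi : i ∈ Finset.Icc 1 P.N) :
    dualCoef P r v i r = v (P.x i) := by
  obtain ⟨p, hp, hvp⟩ := hv.2.1 i hi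
  have hlt := P.lt i hi
  have h1 := integral_eq_sum_elemWeight (r := r) hi (q := derivative p)
    ((degree_derivative_lt_of_natDegree_le hr hp).trans_le
      (by exact_mod_cast (show r ≤ 2 * r by omega)))
  rw [intervalIntegral.integral_eq_sub_of_hasDerivAt (fun t _ => p.hasDerivAt t)
    ((Polynomial.continuous _).intervalIntegrable _ _),
    ← hvp _ (Set.left_mem_Icc.2 hlt.le), ← hvp _ (Set.right_mem_Icc.2 hlt.le)] at h1
  rw [dualCoef, Finset.sum_congr rfl fun k hk => by rw [deriv_gpt_eq hi hk hvp], ← h1]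
  ring

/-- The conventions for the extended coefficients hold automatically: the outer ones are `v(a) =
v(b) = 0`, and at an inner `x_i` both neighbours give `v(x_i)`. No case distinction is needed
afterwards. -/
theorem extCoef_dualCoef {P : Partition a b} {r : ℕ} (hr : 1 ≤ r) {v : ℝ → ℝ}
    (hv : v ∈ trialSpace P r) {i j : ℕ} (hi : i ∈ Finset.Icc 1 P.N) :
    extCoef P r (dualCoef P r v) i j = dualCoef P r v i j := by
  have hi' := Finset.mem_Icc.1 hi
  rw [extCoef]
  split_ifs with h1 h2
  · rcases h1 with ⟨rfl, rfl⟩ | ⟨rfl, rfl⟩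
    · simp [dualCoef, P.x_zero, hv.2.2.1]
    · rw [dualCoef_last hr hv hi, P.x_N, hv.2.2.2]
  · subst h2
    have : i - 1 ∈ Finset.Icc 1 P.N := by
      have : i ≠ 1 := fun h => h1 (Or.inl ⟨h, rfl⟩)
      exact Finset.mem_Icc.2 ⟨by omega, by omega⟩
    rw [dualCoef_last hr hv this]
    simp [dualCoef]
  · rfl

theorem jump_dualCoef {P : Partition a b} {r : ℕ} (hr : 1 ≤ r) {v : ℝ → ℝ}
    (hv : v ∈ trialSpace P r) {i j : ℕ} (hi : i ∈ Finset.Icc 1 P.N) (hj : j ∈ Finset.Icc 1 r) :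
    jump P r (dualCoef P r v) i j = elemWeight P r i j * deriv v (gpt P r i j) := by
  have hj' := Finset.mem_Icc.1 hj
  obtain ⟨k, rfl⟩ : ∃ k, j = k + 1 := ⟨j - 1, by omega⟩
  rw [jump, extCoef_dualCoef hr hv hi, extCoef_dualCoef hr hv hi, dualCoef, dualCoef,
    add_tsub_cancel_right, Finset.sum_Icc_succ_top (by omega)]
  ring

/-- The dual coefficients approximate the values of the trial function. -/
theorem sq_dualCoef_sub_le {P : Partition a b} {r : ℕ} (hr : 1 ≤ r) {v : ℝ → ℝ}
    (hv : v ∈ trialSpace P r) {i j : ℕ} (hi : i ∈ Finset.Icc 1 P.N) (hj : j ≤ r) {x : ℝ}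
    (hx : x ∈ Set.Icc (P.x (i - 1)) (P.x i)) :
    (dualCoef P r v i j - v x) ^ 2 ≤
      4 * P.h i * ∫ x in Set.Ioo (P.x (i - 1)) (P.x i), deriv v x ^ 2 := by
  obtain ⟨p, hp, hvp⟩ := hv.2.1 i hi
  have hlt := P.lt i hi
  have hd := hasH2Data_of_polynomial hvp
  set D := ∫ x in Set.Ioo (P.x (i - 1)) (P.x i), deriv v x ^ 2 with hD
  have h1 : (v x - v (P.x (i - 1))) ^ 2 ≤ P.h i * D := by
    have h2 := FVM.sq_integral_abs_le hlt
      (memLp_two_of_continuousOn (hd.continuousOn_deriv hlt))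
    rw [hd.sub_eq_integral hlt le_rfl hx.1 hx.2, hD, hd.integral_sq_deriv hlt]
    refine le_trans ?_ h2
    have := abs_integral_le_integral_abs (f := fun x => (derivative p).eval x)
      ((Polynomial.continuous _).intervalIntegrable _ _) (le_refl (P.x (i - 1))) hx.1 hx.2
    exact sq_le_sq' (abs_le.1 this).1 (abs_le.1 this).2
  -- Cauchy-Schwarz for a partial quadrature sum: the weights add up to at most `h_i`, and the full
  -- sum of weighted `(v')²` is exactly `D`.
  have h3 : (dualCoef P r v i j - v (P.x (i - 1))) ^ 2 ≤ P.h i * D := by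
    rw [hD, integral_sq_deriv_eq_sum hr hi hp hvp, ← sum_elemWeight P hr i, dualCoef,
      add_sub_cancel_left]
    have hsub : Finset.Icc 1 j ⊆ Finset.Icc 1 r := Finset.Icc_subset_Icc_right hj
    have h4 : ∀ k ∈ Finset.Icc 1 r, 0 ≤ elemWeight P r i k := fun k hk =>
      (elemWeight_pos hi hk).le
    have h5 : ∀ k ∈ Finset.Icc 1 r, 0 ≤ elemWeight P r i k * deriv v (gpt P r i k) ^ 2 :=
      fun k hk => mul_nonneg (h4 k hk) (sq_nonneg _)
    refine (Finset.sum_sq_le_sum_mul_sum_of_sq_le_mul (Finset.Icc 1 j)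
      (f := fun k => elemWeight P r i k)
      (g := fun k => elemWeight P r i k * deriv v (gpt P r i k) ^ 2)
      (fun k hk => h4 k (hsub hk)) (fun k hk => h5 k (hsub hk))
      fun k _ => le_of_eq (by ring)).trans ?_
    exact mul_le_mul (Finset.sum_le_sum_of_subset_of_nonneg hsub fun k hk _ => h4 k hk)
      (Finset.sum_le_sum_of_subset_of_nonneg hsub fun k hk _ => h5 k hk)
      (Finset.sum_nonneg fun k hk => h5 k (hsub hk)) (Finset.sum_nonneg h4)
  nlinarith [sq_nonneg ((dualCoef P r v i j - v (P.x (i - 1))) + (v x - v (P.x (i - 1))))]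

/-- The constant in the stability estimate for the dual coefficients. -/
noncomputable def dualConst (r : ℕ) (a b : ℝ) : ℝ := 1 + r * (2 + 8 * (b - a) ^ 2)

theorem dualConst_pos (r : ℕ) (a b : ℝ) : 0 < dualConst r a b := by
  unfold dualConst; positivity

/-- Weights are at most `h_i`, so the scaled squared jumps sum to at most `∫ (v')²`. The
coefficients are close to `v` at every point of `τ_i`, and integrating this over `τ_i` bounds `h_i
w_{i,j}²` by `2 ∫ v² + 8 h_i² ∫ (v')²`. -/
theorem sq_normP'_dualCoef_le {P : Partition a b} {r : ℕ} (hr : 1 ≤ r) {v : ℝ → ℝ}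
    (hv : v ∈ trialSpace P r) :
    normP' P r (dualCoef P r v) ^ 2 ≤
      dualConst r a b * ∑ i ∈ Finset.Icc 1 P.N, h1Sq (P.x (i - 1)) (P.x i) v := by
  rw [sq_normP', ← Finset.sum_add_distrib, Finset.mul_sum]
  refine Finset.sum_le_sum fun i hi => ?_
  obtain ⟨p, hp, hvp⟩ := hv.2.1 i hi
  have hlt := P.lt i hi
  have hh := P.h_pos hi
  have hd := hasH2Data_of_polynomial hvp
  set D := ∫ x in Set.Ioo (P.x (i - 1)) (P.x i), deriv v x ^ 2 with hD
  set V := ∫ x in Set.Ioo (P.x (i - 1)) (P.x i), v x ^ 2 with hV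
  have hE : h1Sq (P.x (i - 1)) (P.x i) v = V + D := rfl
  have hD0 : 0 ≤ D := integral_nonneg fun _ => sq_nonneg _
  have hV0 : 0 ≤ V := integral_nonneg fun _ => sq_nonneg _
  have h1 : ∑ j ∈ Finset.Icc 1 r, (P.h i)⁻¹ * jump P r (dualCoef P r v) i j ^ 2 ≤ D := by
    rw [hD, integral_sq_deriv_eq_sum hr hi hp hvp]
    refine Finset.sum_le_sum fun j hj => ?_
    rw [jump_dualCoef hr hv hi hj, mul_pow, sq (elemWeight P r i j), mul_assoc, ← mul_assoc]
    refine mul_le_of_le_one_left (mul_nonneg (elemWeight_pos hi hj).le (sq_nonneg _)) ?_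
    rw [inv_mul_le_iff₀ hh, mul_one]
    exact elemWeight_le hr hi hj
  have h2 : ∀ j ∈ Finset.Icc 1 r, P.h i * dualCoef P r v i j ^ 2 ≤
      (2 + 8 * (b - a) ^ 2) * (V + D) := by
    intro j hj
    have hmono : ∫ _ in P.x (i - 1)..P.x i, dualCoef P r v i j ^ 2 ≤
        ∫ x in P.x (i - 1)..P.x i, (2 * v x ^ 2 + 2 * (4 * P.h i * D)) := by
      have hi2 : IntervalIntegrable (fun x => v x ^ 2) volume (P.x (i - 1)) (P.x i) := by
        apply ContinuousOn.intervalIntegrable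
        rw [uIcc_of_le hlt.le]
        exact hd.cont.pow 2
      refine intervalIntegral.integral_mono_on hlt.le intervalIntegrable_const
        ((hi2.const_mul 2).add intervalIntegrable_const) fun x hx => ?_
      have := sq_dualCoef_sub_le hr hv hi (Finset.mem_Icc.1 hj).2 hx
      nlinarith [sq_nonneg (dualCoef P r v i j - 2 * v x)]
    have hi2 : IntervalIntegrable (fun x => v x ^ 2) volume (P.x (i - 1)) (P.x i) := by
      apply ContinuousOn.intervalIntegrable
      rw [uIcc_of_le hlt.le]
      exact hd.cont.pow 2
    rw [intervalIntegral.integral_const, intervalIntegral.integral_add (hi2.const_mul 2)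
      intervalIntegrable_const, intervalIntegral.integral_const_mul,
      intervalIntegral.integral_const, smul_eq_mul, smul_eq_mul, ← setIntegral_Ioo_eq hlt.le,
      ← hV, ← Partition.h] at hmono
    have hsq : P.h i ^ 2 ≤ (b - a) ^ 2 := pow_le_pow_left₀ hh.le (P.h_le hi) 2
    nlinarith [mul_le_mul_of_nonneg_right hsq hD0, mul_nonneg (sq_nonneg (b - a)) hV0]
  have hsub : Finset.Icc 1 (rIdx P r i) ⊆ Finset.Icc 1 r := by
    refine Finset.Icc_subset_Icc_right ?_
    rw [rIdx]; split_ifs <;> omega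
  have h3 : ∑ j ∈ Finset.Icc 1 (rIdx P r i), P.h i * dualCoef P r v i j ^ 2 ≤
      r * ((2 + 8 * (b - a) ^ 2) * (V + D)) := by
    refine (Finset.sum_le_sum_of_subset_of_nonneg hsub
      fun j _ _ => mul_nonneg hh.le (sq_nonneg _)).trans ((Finset.sum_le_sum h2).trans ?_)
    rw [Finset.sum_const, Nat.card_Icc, nsmul_eq_mul, add_tsub_cancel_right]
  rw [hE, dualConst]
  nlinarith

/-! ### Coercivity -/

/-- Replacing the test function by the trial function in the lower order terms of an element. -/
theorem Admissible.abs_sum_sub_integral_le (hab : a < b) (h : Admissible a b α₀ κ Λ α β γ)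
    {P : Partition a b} {r : ℕ} (hr : 1 ≤ r) {v : ℝ → ℝ} (hv : v ∈ trialSpace P r) {i : ℕ}
    (hi : i ∈ Finset.Icc 1 P.N) :
    |∑ j ∈ Finset.range (r + 1), extCoef P r (dualCoef P r v) i j *
        (∫ x in node P r i j..node P r i (j + 1), (β x * deriv v x + γ x * v x))
      - ∫ x in P.x (i - 1)..P.x i, v x * (β x * deriv v x + γ x * v x)|
      ≤ 3 * Λ * P.h i * h1Sq (P.x (i - 1)) (P.x i) v := by
  have hΛ := h.Λ_nonneg hab
  have hlt := P.lt i hi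
  have hh := P.h_pos hi
  have hpw := isPiecewiseH2_of_mem_trialSpace hv
  obtain ⟨G, g, hd⟩ := hpw i hi
  set q : ℝ → ℝ := fun x => β x * deriv v x + γ x * v x with hq
  have hqi : IntervalIntegrable q volume (P.x (i - 1)) (P.x i) := h.intervalIntegrable hpw hi
  have hvq : IntervalIntegrable (fun x => v x * q x) volume (P.x (i - 1)) (P.x i) := by
    refine hqi.continuousOn_mul ?_
    rw [uIcc_of_le hlt.le]
    exact hd.cont
  set D := ∫ x in Set.Ioo (P.x (i - 1)) (P.x i), deriv v x ^ 2 with hD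
  have hD0 : 0 ≤ D := integral_nonneg fun _ => sq_nonneg _
  set E := h1Sq (P.x (i - 1)) (P.x i) v with hE
  have hE0 : 0 ≤ E := h1Sq_nonneg _ _ _
  have hDE : D ≤ E := integral_sq_deriv_le_h1Sq _ _ _
  set δ := Real.sqrt (4 * P.h i * D) with hδ
  set Q := ∫ x in P.x (i - 1)..P.x i, |q x| with hQ
  have hQ0 : 0 ≤ Q := intervalIntegral.integral_nonneg hlt.le fun _ _ => abs_nonneg _
  have hQ2 : Q ^ 2 ≤ 2 * Λ ^ 2 * P.h i * E := h.sq_integral_abs_le hpw hi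
  have hle : |∑ j ∈ Finset.range (r + 1), extCoef P r (dualCoef P r v) i j *
        (∫ x in node P r i j..node P r i (j + 1), q x)
      - ∫ x in P.x (i - 1)..P.x i, v x * q x| ≤ δ * Q := by
    rw [← sum_integral_node (r := r) hi hvq, ← Finset.sum_sub_distrib, hQ,
      ← sum_integral_node (r := r) hi hqi.abs, Finset.mul_sum]
    refine (Finset.abs_sum_le_sum_abs _ _).trans (Finset.sum_le_sum fun j hj => ?_)
    have hj' := Finset.mem_range.1 hj
    have i₁ := intervalIntegrable_node (r := r) (j := j) (k := j + 1) hi hqi (by omega) (by omega)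
    have i₂ := intervalIntegrable_node (r := r) (j := j) (k := j + 1) hi hvq (by omega) (by omega)
    have hn := node_le P (r := r) (j := j) hi (by omega)
    rw [extCoef_dualCoef hr hv hi, ← intervalIntegral.integral_const_mul,
      ← intervalIntegral.integral_sub (i₁.const_mul _) i₂, ← intervalIntegral.integral_const_mul]
    refine (intervalIntegral.abs_integral_le_integral_abs hn).trans
      (intervalIntegral.integral_mono_on hn ((i₁.const_mul _).sub i₂).abs (i₁.abs.const_mul _)
        fun x hx => ?_)
    rw [← sub_mul, abs_mul]
    refine mul_le_mul_of_nonneg_right ?_ (abs_nonneg _)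
    exact Real.abs_le_sqrt (sq_dualCoef_sub_le hr hv hi (by omega)
      ⟨(node_mem P hi (by omega)).1.trans hx.1, hx.2.trans (node_mem P hi (by omega)).2⟩)
  -- Squaring gives the factor `4 · 2 = 8`, rounded up to `9 = 3²`.
  refine hle.trans (abs_le_of_sq_le_sq' ?_ (by positivity)).2
  rw [mul_pow, hδ, Real.sq_sqrt (by positivity)]
  calc 4 * P.h i * D * Q ^ 2 ≤ 4 * P.h i * E * (2 * Λ ^ 2 * P.h i * E) := by gcongr
    _ ≤ (3 * Λ * P.h i * E) ^ 2 := by nlinarith [sq_nonneg (Λ * P.h i * E)]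

/-- Coercivity of the lower order terms. -/
theorem Admissible.mul_integral_sq_le (hab : a < b) (h : Admissible a b α₀ κ Λ α β γ)
    {P : Partition a b} {r : ℕ} {v : ℝ → ℝ} (hv : v ∈ trialSpace P r) :
    κ * ∑ i ∈ Finset.Icc 1 P.N, ∫ x in Set.Ioo (P.x (i - 1)) (P.x i), v x ^ 2 ≤
      ∑ i ∈ Finset.Icc 1 P.N,
        ∫ x in P.x (i - 1)..P.x i, v x * (β x * deriv v x + γ x * v x) := by
  obtain ⟨β', hβ'i, hβ', hκ⟩ := h.lower_γ
  have hβi : IntegrableOn β (Set.Ioo a b) :=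
    Integrable.of_bound h.meas_β Λ (by simpa only [Real.norm_eq_abs] using h.bound_β)
  obtain ⟨C, hC⟩ := hβ'.exists_ae_eq hab hβi hβ'i
  have hβ'I := intervalIntegrable_of_Ioo hab.le hβ'i
  -- `B` is the absolutely continuous representative of `β`. Integrating `β (v²)' / 2` by parts
  -- leaves `B v² / 2` at the nodes; these terms telescope to zero since `v` vanishes at `a` and
  -- `b`.
  set B : ℝ → ℝ := fun x => C + ∫ t in a..x, β' t with hB
  have key : ∀ i ∈ Finset.Icc 1 P.N,
      κ * (∫ x in Set.Ioo (P.x (i - 1)) (P.x i), v x ^ 2)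
        + (B (P.x i) * v (P.x i) ^ 2 / 2 - B (P.x (i - 1)) * v (P.x (i - 1)) ^ 2 / 2) ≤
      ∫ x in P.x (i - 1)..P.x i, v x * (β x * deriv v x + γ x * v x) := by
    intro i hi
    obtain ⟨p, -, hvp⟩ := hv.2.1 i hi
    have hbd := P.bounds hi
    have hlt := P.lt i hi
    set c := P.x (i - 1)
    set d := P.x i
    have hsubset : Set.uIcc c d ⊆ Set.uIcc a b := by
      rw [uIcc_of_le hlt.le, uIcc_of_le hab.le]
      exact Set.Icc_subset_Icc hbd.1 hbd.2.2
    have hloc : ∀ {s : ℝ → Prop}, (∀ᵐ x ∂(volume.restrict (Set.Ioo a b)), s x) →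
        ∀ᵐ x, x ∈ Set.Ioo c d → s x := by
      intro s hs
      filter_upwards [(ae_restrict_iff' measurableSet_Ioo).1 hs] with x hx hx'
      exact hx (Ioo_subset_of_mem hi hx')
    have hmeas : volume.restrict (Set.Ioo c d) ≤ volume.restrict (Set.Ioo a b) :=
      Measure.restrict_mono (Ioo_subset_of_mem hi) le_rfl
    have hβ'c : IntervalIntegrable β' volume c d := hβ'I.mono_set hsubset
    have hp2 : IntervalIntegrable (fun x => p.eval x ^ 2) volume c d :=
      ((Polynomial.continuous _).pow 2).intervalIntegrable _ _
    have hβ'p : IntervalIntegrable (fun x => β' x * p.eval x ^ 2) volume c d :=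
      hβ'c.mul_continuousOn ((Polynomial.continuous _).pow 2).continuousOn
    have hγp : IntervalIntegrable (fun x => γ x * p.eval x ^ 2) volume c d :=
      intervalIntegrable_bdd_mul hlt.le (h.meas_γ.mono_measure hmeas)
        (ae_mono hmeas h.bound_γ) hp2
    have hder : ∀ x, deriv (fun y => p.eval y ^ 2) x = 2 * p.eval x * (derivative p).eval x := by
      intro x
      have : HasDerivAt (fun y => p.eval y ^ 2) _ x := (p.hasDerivAt x).pow 2
      rw [this.deriv]
      simp
    have hβp : IntervalIntegrable
        (fun x => β x * deriv (fun y => p.eval y ^ 2) x) volume c d := by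
      refine intervalIntegrable_bdd_mul hlt.le (h.meas_β.mono_measure hmeas)
        (ae_mono hmeas h.bound_β) ?_
      rw [show deriv (fun y => p.eval y ^ 2) = fun x => 2 * p.eval x * (derivative p).eval x from
        funext hder]
      exact ((continuous_const.mul (Polynomial.continuous _)).mul
        (Polynomial.continuous _)).intervalIntegrable _ _
    have hBeq : ∀ x ∈ Set.Ioo c d, B x = B c + ∫ t in c..x, β' t := by
      intro x hx
      have hcm : c ∈ Set.Icc a b := ⟨hbd.1, hlt.le.trans hbd.2.2⟩
      have hxm : x ∈ Set.Icc a b := ⟨hbd.1.trans hx.1.le, hx.2.le.trans hbd.2.2⟩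
      have j₁ := hβ'I.mono_set (uIcc_subset_Icc_of_mem hcm)
      have j₂ := hβ'I.mono_set (uIcc_subset_Icc_of_mem hxm)
      rw [hB]
      simp only
      rw [← intervalIntegral.integral_interval_sub_left j₂ j₁]
      ring
    have hBd : B d = B c + ∫ t in c..d, β' t := by
      have hcm : c ∈ Set.Icc a b := ⟨hbd.1, hlt.le.trans hbd.2.2⟩
      have hxm : d ∈ Set.Icc a b := ⟨hbd.1.trans hlt.le, hbd.2.2⟩
      have j₁ := hβ'I.mono_set (uIcc_subset_Icc_of_mem hcm)
      have j₂ := hβ'I.mono_set (uIcc_subset_Icc_of_mem hxm)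
      rw [hB]
      simp only
      rw [← intervalIntegral.integral_interval_sub_left j₂ j₁]
      ring
    have hibp := integral_primitive_mul_deriv (B c) hβ'c
      (φ := fun y => p.eval y ^ 2) ((show ContDiff ℝ 1 fun y => p.eval y by
        simpa only [coe_aeval_eq_eval] using p.contDiff_aeval (𝕜 := ℝ) 1).pow 2)
    rw [← hBd] at hibp
    have hβint : ∫ x in c..d, β x * deriv (fun y => p.eval y ^ 2) x
        = B d * v d ^ 2 - B c * v c ^ 2 - ∫ x in c..d, β' x * p.eval x ^ 2 := by
      rw [hvp c (Set.left_mem_Icc.2 hlt.le), hvp d (Set.right_mem_Icc.2 hlt.le), ← hibp,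
        ← setIntegral_Ioo_eq hlt.le, ← setIntegral_Ioo_eq hlt.le]
      refine setIntegral_congr_ae measurableSet_Ioo ?_
      filter_upwards [hC] with x hx hx'
      rw [hx (Ioo_subset_of_mem hi hx'), ← hBeq x hx']
    have hqv : ∫ x in c..d, v x * (β x * deriv v x + γ x * v x)
        = 1 / 2 * (∫ x in c..d, β x * deriv (fun y => p.eval y ^ 2) x)
          + ∫ x in c..d, γ x * p.eval x ^ 2 := by
      rw [← intervalIntegral.integral_const_mul,
        ← intervalIntegral.integral_add (hβp.const_mul _) hγp, ← setIntegral_Ioo_eq hlt.le,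
        ← setIntegral_Ioo_eq hlt.le]
      refine setIntegral_congr_fun measurableSet_Ioo fun x hx => ?_
      simp only [hder]
      rw [hvp x (Set.Ioo_subset_Icc_self hx), (hasH2Data_of_polynomial hvp).deriv_eq hx]
      ring
    have hlow : κ * (∫ x in Set.Ioo c d, v x ^ 2) ≤
        (∫ x in c..d, γ x * p.eval x ^ 2) - 1 / 2 * ∫ x in c..d, β' x * p.eval x ^ 2 := by
      rw [← intervalIntegral.integral_const_mul,
        ← intervalIntegral.integral_sub hγp (hβ'p.const_mul _), ← integral_const_mul,
        ← setIntegral_Ioo_eq hlt.le]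
      have hvv : IntegrableOn (fun x => v x ^ 2) (Set.Ioo c d) :=
        ((intervalIntegrable_iff_integrableOn_Ioo_of_le hlt.le).1 hp2).congr_fun
          (fun x hx => by simp only [hvp x (Set.Ioo_subset_Icc_self hx)]) measurableSet_Ioo
      refine setIntegral_mono_on_ae (hvv.const_mul κ)
        ((intervalIntegrable_iff_integrableOn_Ioo_of_le hlt.le).1 (hγp.sub (hβ'p.const_mul _)))
        measurableSet_Ioo ?_
      filter_upwards [hloc hκ] with x hx hx'
      rw [hvp x (Set.Ioo_subset_Icc_self hx')]
      nlinarith [mul_le_mul_of_nonneg_right (hx hx') (sq_nonneg (p.eval x))]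
    rw [hqv, hβint]
    linarith
  have hsum := Finset.sum_le_sum key
  rw [Finset.sum_add_distrib,
    sum_Icc_one_sub_pred (fun i => B (P.x i) * v (P.x i) ^ 2 / 2), P.x_N, P.x_zero, hv.2.2.1,
    hv.2.2.2] at hsum
  rw [Finset.mul_sum]
  linarith

/-- The diffusion part dominates `α₀ ∫ (v')²` by exact quadrature. The lower order part dominates `κ
∫ v²` up to an error `3 Λ h` times the squared `H¹` norm, and the mesh condition lets this error
consume at most half of `min α₀ κ`. -/
theorem Admissible.mul_sum_h1Sq_le (hab : a < b)
    (h : Admissible a b α₀ κ Λ α β γ) {P : Partition a b} {r : ℕ} (hr : 1 ≤ r)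
    (hα : ∀ i ∈ Finset.Icc 1 P.N, ∀ j ∈ Finset.Icc 1 r, ContinuousAt α (gpt P r i j))
    {h₀ : ℝ} (hh : ∀ i ∈ Finset.Icc 1 P.N, P.h i ≤ h₀) (hh₀ : 3 * Λ * h₀ ≤ min α₀ κ / 2)
    {v : ℝ → ℝ} (hv : v ∈ trialSpace P r) :
    min α₀ κ / 2 * ∑ i ∈ Finset.Icc 1 P.N, h1Sq (P.x (i - 1)) (P.x i) v ≤
      aP α β γ P r v (dualCoef P r v) := by
  have hΛ := h.Λ_nonneg hab
  have hpw := isPiecewiseH2_of_mem_trialSpace hv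
  rw [aP_eq hr _ fun i hi => h.intervalIntegrable hpw hi, Finset.sum_add_distrib]
  have h1 : α₀ * ∑ i ∈ Finset.Icc 1 P.N, ∫ x in Set.Ioo (P.x (i - 1)) (P.x i), deriv v x ^ 2 ≤
      ∑ i ∈ Finset.Icc 1 P.N, ∑ j ∈ Finset.Icc 1 r,
        jump P r (dualCoef P r v) i j * α (gpt P r i j) * deriv v (gpt P r i j) := by
    rw [Finset.mul_sum]
    refine Finset.sum_le_sum fun i hi => ?_
    obtain ⟨p, hp, hvp⟩ := hv.2.1 i hi
    rw [integral_sq_deriv_eq_sum hr hi hp hvp, Finset.mul_sum]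
    refine Finset.sum_le_sum fun j hj => ?_
    rw [jump_dualCoef hr hv hi hj]
    have h2 := le_of_continuousAt_of_ae (gpt_mem_Ioo P hi hj) (hα i hi j hj) h.lower_α
    have h3 := mul_nonneg (elemWeight_pos hi hj).le (sq_nonneg (deriv v (gpt P r i j)))
    nlinarith [mul_le_mul_of_nonneg_right h2 h3]
  have h2 := h.mul_integral_sq_le hab hv
  have h3 : (∑ i ∈ Finset.Icc 1 P.N,
        ∫ x in P.x (i - 1)..P.x i, v x * (β x * deriv v x + γ x * v x))
      - ∑ i ∈ Finset.Icc 1 P.N, ∑ j ∈ Finset.range (r + 1),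
        extCoef P r (dualCoef P r v) i j *
          (∫ x in node P r i j..node P r i (j + 1), (β x * deriv v x + γ x * v x)) ≤
      min α₀ κ / 2 * ∑ i ∈ Finset.Icc 1 P.N, h1Sq (P.x (i - 1)) (P.x i) v := by
    rw [← Finset.sum_sub_distrib, Finset.mul_sum]
    refine Finset.sum_le_sum fun i hi => ?_
    have h4 := (abs_le.1 (h.abs_sum_sub_integral_le hab hr hv hi)).1
    have h5 : 3 * Λ * P.h i ≤ min α₀ κ / 2 :=
      (mul_le_mul_of_nonneg_left (hh i hi) (by positivity)).trans hh₀
    have h6 := mul_le_mul_of_nonneg_right h5 (h1Sq_nonneg (P.x (i - 1)) (P.x i) v)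
    linarith
  have h7 : ∑ i ∈ Finset.Icc 1 P.N, h1Sq (P.x (i - 1)) (P.x i) v =
      (∑ i ∈ Finset.Icc 1 P.N, ∫ x in Set.Ioo (P.x (i - 1)) (P.x i), v x ^ 2) +
      ∑ i ∈ Finset.Icc 1 P.N, ∫ x in Set.Ioo (P.x (i - 1)) (P.x i), deriv v x ^ 2 := by
    rw [← Finset.sum_add_distrib]; rfl
  have h8 : ∀ f : ℝ → ℝ, 0 ≤ ∑ i ∈ Finset.Icc 1 P.N,
      ∫ x in Set.Ioo (P.x (i - 1)) (P.x i), f x ^ 2 := fun f =>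
    Finset.sum_nonneg fun i _ => integral_nonneg fun _ => sq_nonneg _
  have h9 := mul_le_mul_of_nonneg_right (min_le_left α₀ κ) (h8 (deriv v))
  have h10 := mul_le_mul_of_nonneg_right (min_le_right α₀ κ) (h8 v)
  rw [h7] at h3 ⊢
  linarith

/-! ### The inf-sup condition -/

/-- The inf-sup constant. -/
noncomputable def infSupConst (r : ℕ) (a b α₀ κ : ℝ) : ℝ :=
  min α₀ κ / (2 * Real.sqrt (dualConst r a b * (1 + inverseConst r)))

theorem infSupConst_pos (r : ℕ) (a b : ℝ) (hα₀ : 0 < α₀) (hκ : 0 < κ) :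
    0 < infSupConst r a b α₀ κ := by
  have h1 := dualConst_pos r a b
  have h2 := inverseConst_nonneg r
  exact div_pos (lt_min hα₀ hκ) (by positivity)

/-- Coercivity, stability of the dual coefficients and the inverse inequality are combined through
the squared `H¹` norm `E`. An explicit test function is kept, since quasi-optimality needs one and
not merely a supremum. -/
theorem Admissible.exists_test (hab : a < b) (hα₀ : 0 < α₀) (hκ : 0 < κ)
    (h : Admissible a b α₀ κ Λ α β γ) {P : Partition a b} {r : ℕ} (hr : 1 ≤ r)
    (hα : ∀ i ∈ Finset.Icc 1 P.N, ∀ j ∈ Finset.Icc 1 r, ContinuousAt α (gpt P r i j))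
    {h₀ : ℝ} (hh : ∀ i ∈ Finset.Icc 1 P.N, P.h i ≤ h₀) (hh₀ : 3 * Λ * h₀ ≤ min α₀ κ / 2)
    {v : ℝ → ℝ} (hv : v ∈ trialSpace P r) :
    ∃ w, infSupConst r a b α₀ κ * normP P v ≤ aP α β γ P r v w / normP' P r w := by
  refine ⟨dualCoef P r v, ?_⟩
  have hlow := h.mul_sum_h1Sq_le hab hr hα hh hh₀ hv
  have hw := sq_normP'_dualCoef_le hr hv
  have hvn : normP P v ^ 2 ≤ (1 + inverseConst r) *
      ∑ i ∈ Finset.Icc 1 P.N, h1Sq (P.x (i - 1)) (P.x i) v := by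
    rw [sq_normP, Finset.mul_sum]
    refine Finset.sum_le_sum fun i hi => ?_
    obtain ⟨p, hp, hvp⟩ := hv.2.1 i hi
    exact elemSq_le hr (P.lt i hi) hp hvp
  have hE0 : 0 ≤ ∑ i ∈ Finset.Icc 1 P.N, h1Sq (P.x (i - 1)) (P.x i) v :=
    Finset.sum_nonneg fun _ _ => h1Sq_nonneg _ _ _
  have hbound := h.abs_aP_le hab hr hα (isPiecewiseH2_of_mem_trialSpace hv) (dualCoef P r v)
  set E := ∑ i ∈ Finset.Icc 1 P.N, h1Sq (P.x (i - 1)) (P.x i) v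
  set A := aP α β γ P r v (dualCoef P r v)
  have hm : 0 < min α₀ κ := lt_min hα₀ hκ
  have hn0 := normP_nonneg P v
  -- If the test norm vanishes, the quotient is `0` by convention; boundedness and coercivity then
  -- force `E = 0`, so `v` has norm zero as well.
  rcases (normP'_nonneg P r (dualCoef P r v)).eq_or_lt with h0 | hpos
  · rw [← h0, mul_zero] at hbound
    have hA : A ≤ 0 := (le_abs_self A).trans hbound
    have hE : E = 0 := by nlinarith
    rw [hE, mul_zero] at hvn
    have hv0 : normP P v = 0 := by nlinarith
    rw [hv0, ← h0]
    simp
  · rw [le_div_iff₀ hpos]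
    refine le_trans ?_ hlow
    have h1 := dualConst_pos r a b
    have h2 := inverseConst_nonneg r
    set s := Real.sqrt (dualConst r a b * (1 + inverseConst r)) with hs
    have hs2 : s ^ 2 = dualConst r a b * (1 + inverseConst r) := Real.sq_sqrt (by positivity)
    have hspos : 0 < s := Real.sqrt_pos.2 (by positivity)
    have hprod : normP P v * normP' P r (dualCoef P r v) ≤ s * E := by
      refine (abs_le_of_sq_le_sq' ?_ (by positivity)).2
      rw [mul_pow, mul_pow, hs2]
      calc normP P v ^ 2 * normP' P r (dualCoef P r v) ^ 2
          ≤ (1 + inverseConst r) * E * (dualConst r a b * E) :=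
            mul_le_mul hvn hw (sq_nonneg _) (by positivity)
        _ = _ := by ring
    rw [infSupConst, mul_assoc, div_mul_eq_mul_div, div_le_iff₀ (by positivity)]
    nlinarith

theorem Admissible.infSup (hab : a < b) (hα₀ : 0 < α₀) (hκ : 0 < κ)
    (h : Admissible a b α₀ κ Λ α β γ) {P : Partition a b} {r : ℕ} (hr : 1 ≤ r)
    (hα : ∀ i ∈ Finset.Icc 1 P.N, ∀ j ∈ Finset.Icc 1 r, ContinuousAt α (gpt P r i j))
    {h₀ : ℝ} (hh : ∀ i ∈ Finset.Icc 1 P.N, P.h i ≤ h₀) (hh₀ : 3 * Λ * h₀ ≤ min α₀ κ / 2) :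
    InfSup α β γ P r (infSupConst r a b α₀ κ) := by
  intro v hv
  obtain ⟨w, hw⟩ := h.exists_test hab hα₀ hκ hr hα hh hh₀ hv
  refine hw.trans (le_ciSup (f := fun w => aP α β γ P r v w / normP' P r w) ?_ w)
  -- Boundedness of the form provides the upper bound on the quotients that the real supremum
  -- requires.
  refine ⟨boundConst r a b * Λ * normP P v, ?_⟩
  rintro _ ⟨w, rfl⟩
  have hΛ := h.Λ_nonneg hab
  have := boundConst_nonneg r a b
  have := normP_nonneg P v
  exact div_le_of_le_mul₀ (normP'_nonneg P r w) (by positivity)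
    ((le_abs_self _).trans (h.abs_aP_le hab hr hα (isPiecewiseH2_of_mem_trialSpace hv) w))

/-! ### Linearity -/

theorem lin_mem_trialSpace {P : Partition a b} {r : ℕ} {v₁ v₂ : ℝ → ℝ} (h₁ : v₁ ∈ trialSpace P r)
    (h₂ : v₂ ∈ trialSpace P r) (s t : ℝ) : (fun x => s * v₁ x + t * v₂ x) ∈ trialSpace P r := by
  refine ⟨(continuousOn_const.mul h₁.1).add (continuousOn_const.mul h₂.1), fun i hi => ?_, ?_, ?_⟩
  · obtain ⟨p₁, d₁, e₁⟩ := h₁.2.1 i hi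
    obtain ⟨p₂, d₂, e₂⟩ := h₂.2.1 i hi
    refine ⟨C s * p₁ + C t * p₂, ?_, fun x hx => by simp [e₁ x hx, e₂ x hx]⟩
    exact natDegree_add_le_of_degree_le ((natDegree_C_mul_le _ _).trans d₁)
      ((natDegree_C_mul_le _ _).trans d₂)
  · simp [h₁.2.2.1, h₂.2.2.1]
  · simp [h₁.2.2.2, h₂.2.2.2]

theorem HasH2Data.deriv_lin {c d : ℝ} {v₁ G₁ g₁ v₂ G₂ g₂ : ℝ → ℝ}
    (h₁ : HasH2Data c d v₁ G₁ g₁) (h₂ : HasH2Data c d v₂ G₂ g₂) (s t : ℝ) {x : ℝ}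
    (hx : x ∈ Set.Ioo c d) :
    deriv (fun x => s * v₁ x + t * v₂ x) x = s * deriv v₁ x + t * deriv v₂ x := by
  rw [h₁.deriv_eq hx, h₂.deriv_eq hx]
  exact (((h₁.hasDerivAt x hx).const_mul s).add ((h₂.hasDerivAt x hx).const_mul t)).deriv

theorem Admissible.aP_lin (h : Admissible a b α₀ κ Λ α β γ) {P : Partition a b} {r : ℕ}
    (hr : 1 ≤ r) {v₁ v₂ : ℝ → ℝ} (h₁ : IsPiecewiseH2 P v₁) (h₂ : IsPiecewiseH2 P v₂) (s t : ℝ)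
    (w : ℕ → ℕ → ℝ) :
    aP α β γ P r (fun x => s * v₁ x + t * v₂ x) w
      = s * aP α β γ P r v₁ w + t * aP α β γ P r v₂ w := by
  rw [aP_eq hr w fun i hi => h.intervalIntegrable (h₁.lin h₂ s t) hi,
    aP_eq hr w fun i hi => h.intervalIntegrable h₁ hi,
    aP_eq hr w fun i hi => h.intervalIntegrable h₂ hi, Finset.mul_sum, Finset.mul_sum,
    ← Finset.sum_add_distrib]
  refine Finset.sum_congr rfl fun i hi => ?_
  obtain ⟨G₁, g₁, d₁⟩ := h₁ i hi
  obtain ⟨G₂, g₂, d₂⟩ := h₂ i hi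
  rw [mul_add, mul_add, add_add_add_comm, Finset.mul_sum, Finset.mul_sum, Finset.mul_sum,
    Finset.mul_sum, ← Finset.sum_add_distrib, ← Finset.sum_add_distrib]
  congr 1
  · refine Finset.sum_congr rfl fun j hj => ?_
    rw [d₁.deriv_lin d₂ s t (gpt_mem P hi hj)]
    ring
  · refine Finset.sum_congr rfl fun j hj => ?_
    have hj' := Finset.mem_range.1 hj
    have hn := node_le P (r := r) (j := j) hi (by omega)
    have i₁ := intervalIntegrable_node (r := r) (j := j) (k := j + 1) hi
      (h.intervalIntegrable h₁ hi) (by omega) (by omega)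
    have i₂ := intervalIntegrable_node (r := r) (j := j) (k := j + 1) hi
      (h.intervalIntegrable h₂ hi) (by omega) (by omega)
    have hint : ∫ x in node P r i j..node P r i (j + 1),
        (β x * deriv (fun x => s * v₁ x + t * v₂ x) x + γ x * (s * v₁ x + t * v₂ x))
        = s * (∫ x in node P r i j..node P r i (j + 1), (β x * deriv v₁ x + γ x * v₁ x))
          + t * ∫ x in node P r i j..node P r i (j + 1), (β x * deriv v₂ x + γ x * v₂ x) := by
      rw [← intervalIntegral.integral_const_mul, ← intervalIntegral.integral_const_mul,
        ← intervalIntegral.integral_add (i₁.const_mul s) (i₂.const_mul t),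
        ← setIntegral_Ioo_eq hn, ← setIntegral_Ioo_eq hn]
      refine setIntegral_congr_fun measurableSet_Ioo fun x hx => ?_
      have hx' : x ∈ Set.Ioo (P.x (i - 1)) (P.x i) :=
        ⟨(node_mem P hi (by omega)).1.trans_lt hx.1, hx.2.trans_le (node_mem P hi (by omega)).2⟩
      simp only [d₁.deriv_lin d₂ s t hx']
      ring
    rw [hint]
    ring

theorem integral_sq_lin {μ : Measure ℝ} {f₁ f₂ : ℝ → ℝ} (h₁ : MemLp f₁ 2 μ) (h₂ : MemLp f₂ 2 μ)
    (s t : ℝ) :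
    ∫ x, (s * f₁ x + t * f₂ x) ^ 2 ∂μ = s ^ 2 * (∫ x, f₁ x ^ 2 ∂μ)
      + 2 * s * t * (∫ x, f₁ x * f₂ x ∂μ) + t ^ 2 * ∫ x, f₂ x ^ 2 ∂μ := by
  have i₁ := h₁.integrable_sq.const_mul (s ^ 2)
  have i₂ := h₂.integrable_sq.const_mul (t ^ 2)
  have i₁₂ : Integrable (fun x => 2 * s * t * (f₁ x * f₂ x)) μ :=
    (h₁.integrable_mul h₂).const_mul (2 * s * t)
  have i₃ : Integrable (fun x => s ^ 2 * f₁ x ^ 2 + 2 * s * t * (f₁ x * f₂ x)) μ := i₁.add i₁₂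
  rw [← integral_const_mul, ← integral_const_mul, ← integral_const_mul, ← integral_add i₁ i₁₂,
    ← integral_add i₃ i₂]
  congr 1 with x
  ring

/-- `B` is the local inner product of the two functions. Quasi-optimality needs only that the norm
is quadratic with some cross term, not its value. -/
theorem HasH2Data.exists_elemSq_lin {c d : ℝ} (hcd : c < d) {v₁ G₁ g₁ v₂ G₂ g₂ : ℝ → ℝ}
    (h₁ : HasH2Data c d v₁ G₁ g₁) (h₂ : HasH2Data c d v₂ G₂ g₂) :
    ∃ B : ℝ, ∀ s t : ℝ, elemSq c d (fun x => s * v₁ x + t * v₂ x)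
      = s ^ 2 * elemSq c d v₁ + 2 * s * t * B + t ^ 2 * elemSq c d v₂ := by
  refine ⟨(∫ x in Set.Ioo c d, v₁ x * v₂ x) + (∫ x in Set.Ioo c d, G₁ x * G₂ x)
    + (d - c) ^ 2 * ∫ x in Set.Ioo c d, g₁ x * g₂ x, fun s t => ?_⟩
  have m₁ := memLp_two_of_continuousOn h₁.cont
  have m₂ := memLp_two_of_continuousOn h₂.cont
  have n₁ := memLp_two_of_continuousOn (h₁.continuousOn_deriv hcd)
  have n₂ := memLp_two_of_continuousOn (h₂.continuousOn_deriv hcd)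
  rw [(h₁.lin h₂ hcd s t).elemSq_eq hcd, h₁.elemSq_eq hcd, h₂.elemSq_eq hcd]
  simp only [← setIntegral_Ioo_eq hcd.le]
  rw [integral_sq_lin m₁ m₂, integral_sq_lin n₁ n₂, integral_sq_lin h₁.memLp h₂.memLp]
  ring

theorem IsPiecewiseH2.exists_sq_normP_lin {P : Partition a b} {v₁ v₂ : ℝ → ℝ}
    (h₁ : IsPiecewiseH2 P v₁) (h₂ : IsPiecewiseH2 P v₂) :
    ∃ B : ℝ, ∀ s t : ℝ, normP P (fun x => s * v₁ x + t * v₂ x) ^ 2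
      = s ^ 2 * normP P v₁ ^ 2 + 2 * s * t * B + t ^ 2 * normP P v₂ ^ 2 := by
  have : ∀ i : ℕ, ∃ B : ℝ, i ∈ Finset.Icc 1 P.N → ∀ s t : ℝ,
      elemSq (P.x (i - 1)) (P.x i) (fun x => s * v₁ x + t * v₂ x)
        = s ^ 2 * elemSq (P.x (i - 1)) (P.x i) v₁ + 2 * s * t * B
          + t ^ 2 * elemSq (P.x (i - 1)) (P.x i) v₂ := by
    intro i
    by_cases hi : i ∈ Finset.Icc 1 P.N
    · obtain ⟨G₁, g₁, d₁⟩ := h₁ i hi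
      obtain ⟨G₂, g₂, d₂⟩ := h₂ i hi
      obtain ⟨B, hB⟩ := d₁.exists_elemSq_lin (P.lt i hi) d₂
      exact ⟨B, fun _ => hB⟩
    · exact ⟨0, fun h => absurd h hi⟩
  choose B hB using this
  refine ⟨∑ i ∈ Finset.Icc 1 P.N, B i, fun s t => ?_⟩
  rw [sq_normP, sq_normP, sq_normP, Finset.mul_sum, Finset.mul_sum, Finset.mul_sum,
    ← Finset.sum_add_distrib, ← Finset.sum_add_distrib]
  exact Finset.sum_congr rfl fun i hi => hB i hi s t

/-! ### Quasi-optimality -/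

/-- The identity of Xu and Zikatanov for projections in an inner product space, for two vectors
with squared norms `Q ^ 2`, `R ^ 2` and inner product `B`: if `t R ≤ K ‖s q + t p‖` for all
coefficients, then `Q ≤ K ‖q + p‖`. -/
theorem le_mul_of_forall_projection_le {Q R B K : ℝ} {n : ℝ → ℝ → ℝ} (hQ : 0 ≤ Q) (hR : 0 ≤ R)
    (hK : 1 ≤ K) (hn : ∀ s t, 0 ≤ n s t)
    (hn2 : ∀ s t, n s t ^ 2 = s ^ 2 * Q ^ 2 + 2 * s * t * B + t ^ 2 * R ^ 2)
    (h : ∀ s t, 0 ≤ t → t * R ≤ K * n s t) : Q ≤ K * n 1 1 := by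
  rcases hQ.eq_or_lt with rfl | hQ
  · exact mul_nonneg (by linarith) (hn _ _)
  rcases hR.eq_or_lt with rfl | hR
  · have hB : B = 0 := by
      by_contra hB
      have h1 := hn2 1 (-(Q ^ 2 + 1) / (2 * B))
      -- With `R = 0` and `B ≠ 0`, this choice of `t` would make the square equal to `-1`.
      have h2 : 2 * 1 * (-(Q ^ 2 + 1) / (2 * B)) * B = -(Q ^ 2 + 1) := by field_simp
      rw [h2] at h1
      nlinarith [sq_nonneg (n 1 (-(Q ^ 2 + 1) / (2 * B)))]
    have h1 := hn2 1 1
    rw [hB] at h1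
    have h2 : n 1 1 = Q := by
      rw [← sq_eq_sq₀ (hn 1 1) hQ.le, h1]; ring
    rw [h2]
    exact le_mul_of_one_le_left hQ.le hK
  -- The scaling exchanges the lengths of the two vectors and keeps their inner product because `s t
  -- = 1`, so the norm of the sum is unchanged while `t R` becomes `Q`.
  · have h1 : n (R / Q) (Q / R) = n 1 1 := by
      rw [← sq_eq_sq₀ (hn _ _) (hn _ _), hn2, hn2]
      field_simp
      ring
    have h2 := h (R / Q) (Q / R) (by positivity)
    rw [h1, div_mul_cancel₀ _ hR.ne'] at h2
    exact h2

/-- The form annihilates the error `q`, so `a(t p, w) = a(s q + t p, w)` for all `s`. Testing with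
the function that realizes the inf-sup bound for `t p` gives `c₂ t ‖p‖ ≤ M ‖s q + t p‖`, the
hypothesis of the projection argument. `M ≥ c₂` serves its degenerate cases. -/
theorem Admissible.normP_sub_le (hab : a < b) (hα₀ : 0 < α₀) (hκ : 0 < κ)
    (h : Admissible a b α₀ κ Λ α β γ) {P : Partition a b} {r : ℕ} (hr : 1 ≤ r)
    (hα : ∀ i ∈ Finset.Icc 1 P.N, ∀ j ∈ Finset.Icc 1 r, ContinuousAt α (gpt P r i j))
    {h₀ : ℝ} (hh : ∀ i ∈ Finset.Icc 1 P.N, P.h i ≤ h₀) (hh₀ : 3 * Λ * h₀ ≤ min α₀ κ / 2)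
    {M : ℝ} (hM : boundConst r a b * Λ ≤ M) (hM' : infSupConst r a b α₀ κ ≤ M)
    {u uP v : ℝ → ℝ} (hu : IsPiecewiseH2 P u) (huP : uP ∈ trialSpace P r)
    (horth : ∀ w, aP α β γ P r u w = aP α β γ P r uP w) (hv : v ∈ trialSpace P r) :
    normP P (u - uP) ≤ M / infSupConst r a b α₀ κ * normP P (u - v) := by
  have hc := infSupConst_pos r a b hα₀ hκ
  set c₂ := infSupConst r a b α₀ κ
  have huP2 := isPiecewiseH2_of_mem_trialSpace huP
  set q : ℝ → ℝ := fun x => 1 * u x + (-1) * uP x with hq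
  set p : ℝ → ℝ := fun x => 1 * uP x + (-1) * v x with hp
  have hqH : IsPiecewiseH2 P q := hu.lin huP2 1 (-1)
  have hpT : p ∈ trialSpace P r := lin_mem_trialSpace huP hv 1 (-1)
  have hpH : IsPiecewiseH2 P p := isPiecewiseH2_of_mem_trialSpace hpT
  have hq0 : ∀ w, aP α β γ P r q w = 0 := by
    intro w
    rw [hq, h.aP_lin hr hu huP2, horth]
    ring
  obtain ⟨B, hB⟩ := hqH.exists_sq_normP_lin hpH
  have e₁ : u - uP = q := by
    funext x; simp only [hq, Pi.sub_apply]; ring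
  have e₂ : u - v = fun x => 1 * q x + 1 * p x := by
    funext x; simp only [hq, hp, Pi.sub_apply]; ring
  rw [e₁, e₂]
  refine le_mul_of_forall_projection_le (R := normP P p)
    (n := fun s t => normP P (fun x => s * q x + t * p x)) (normP_nonneg _ _) (normP_nonneg _ _)
    ((one_le_div hc).2 hM') (fun _ _ => normP_nonneg _ _) hB fun s t ht => ?_
  have htp : normP P (fun x => 0 * q x + t * p x) = t * normP P p := by
    rw [← sq_eq_sq₀ (normP_nonneg _ _) (mul_nonneg ht (normP_nonneg _ _)), hB]
    ring
  have htT : (fun x => 0 * q x + t * p x) ∈ trialSpace P r := by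
    have := lin_mem_trialSpace hpT hpT 0 t
    convert! this using 3
    ring
  obtain ⟨w, hw⟩ := h.exists_test hab hα₀ hκ hr hα hh hh₀ htT
  have ha : aP α β γ P r (fun x => 0 * q x + t * p x) w
      = aP α β γ P r (fun x => s * q x + t * p x) w := by
    rw [h.aP_lin hr hqH hpH, h.aP_lin hr hqH hpH, hq0]
    ring
  rw [htp, ha] at hw
  have hb := h.abs_aP_le hab hr hα (hqH.lin hpH s t) w
  have hn := normP_nonneg P (fun x => s * q x + t * p x)
  have hbc := mul_nonneg (boundConst_nonneg r a b) (h.Λ_nonneg hab)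
  have h2 : aP α β γ P r (fun x => s * q x + t * p x) w / normP' P r w
      ≤ M * normP P (fun x => s * q x + t * p x) := by
    refine (div_le_of_le_mul₀ (normP'_nonneg P r w) (mul_nonneg hbc hn)
      ((le_abs_self _).trans hb)).trans ?_
    exact mul_le_mul_of_nonneg_right hM hn
  rw [div_mul_eq_mul_div, le_div_iff₀ hc, mul_comm]
  exact hw.trans h2

end FVM

/-! ### Choice of the constants and assembly of the theorem -/

theorem theorem3p2 (r : ℕ) (hr : 1 ≤ r) (a b : ℝ) (hab : a < b)
    (α₀ κ : ℝ) (hα₀ : 0 < α₀) (hκ : 0 < κ) :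
    ∃ c₂ : ℝ, 0 < c₂ ∧ ∀ Λ : ℝ, ∃ M : ℝ, 0 < M ∧ ∃ h₀ : ℝ, 0 < h₀ ∧
      ∀ α β γ : ℝ → ℝ, FVM.Admissible a b α₀ κ Λ α β γ →
      ∀ P : FVM.Partition a b,
      -- the point values of `α` used by the scheme are meaningful
      (∀ i ∈ Finset.Icc 1 P.N, ∀ j ∈ Finset.Icc 1 r, ContinuousAt α (FVM.gpt P r i j)) →
        -- variational exactness
        (∀ f u : ℝ → ℝ, MeasureTheory.IntegrableOn f (Set.Ioo a b) →
          FVM.IsSolution a b α β γ f u →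
          ∀ w : ℕ → ℕ → ℝ, FVM.aP α β γ P r u w = FVM.pairing f P r w) ∧
        -- boundedness
        (∀ v : ℝ → ℝ, FVM.MemH10 a b v → FVM.MemBrokenH2 P v → ∀ w : ℕ → ℕ → ℝ,
          |FVM.aP α β γ P r v w| ≤ M * FVM.normP P v * FVM.normP' P r w) ∧
        -- `c₂` is an inf-sup constant and quasi-optimality holds on all fine meshes
        ((∀ i ∈ Finset.Icc 1 P.N, P.h i ≤ h₀) →
          FVM.InfSup α β γ P r c₂ ∧
          ∀ f u uP : ℝ → ℝ, MeasureTheory.IntegrableOn f (Set.Ioo a b) →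
            FVM.IsSolution a b α β γ f u → FVM.MemBrokenH2 P u →
            FVM.IsFVMSolution α β γ f P r uP →
            FVM.normP P (u - uP) ≤
              M / c₂ * ⨅ v : FVM.trialSpace P r, FVM.normP P (u - (v : ℝ → ℝ))) := by
  have hc := FVM.infSupConst_pos r a b hα₀ hκ
  refine ⟨FVM.infSupConst r a b α₀ κ, hc, fun Λ => ?_⟩
  have hB := mul_nonneg (FVM.boundConst_nonneg r a b) (abs_nonneg Λ)
  have hm : 0 < min α₀ κ := lt_min hα₀ hκ
  have hΛ1 : 0 < |Λ| + 1 := by positivity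
  -- Adding `c₂` makes `M` positive and at least `c₂`. `|Λ|` is used because `Λ` is known to be
  -- nonnegative only once admissible coefficients are given. The value of `h₀` yields `3 Λ h₀ ≤ min
  -- α₀ κ / 2`.
  refine ⟨FVM.boundConst r a b * |Λ| + FVM.infSupConst r a b α₀ κ, by linarith,
    min α₀ κ / (6 * (|Λ| + 1)), by positivity, fun α β γ h P hα => ?_⟩
  have hΛ := h.Λ_nonneg hab
  have hh₀ : 3 * Λ * (min α₀ κ / (6 * (|Λ| + 1))) ≤ min α₀ κ / 2 := by
    rw [mul_div_assoc', div_le_div_iff₀ (by positivity) (by norm_num)]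
    nlinarith [le_abs_self Λ]
  have hM : FVM.boundConst r a b * Λ ≤
      FVM.boundConst r a b * |Λ| + FVM.infSupConst r a b α₀ κ := by
    rw [abs_of_nonneg hΛ]; linarith
  refine ⟨fun f u hf hu w => hu.aP_eq_pairing hab hα₀ h hr hα hf w, fun v _ hv w => ?_,
    fun hh => ⟨h.infSup hab hα₀ hκ hr hα hh hh₀, fun f u uP hf hu hu2 huP => ?_⟩⟩
  · refine (h.abs_aP_le hab hr hα hv.isPiecewiseH2 w).trans ?_
    have h1 := FVM.normP_nonneg P v
    have h2 := FVM.normP'_nonneg P r w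
    gcongr
  -- A lower bound for the real infimum requires a nonempty index set; the finite volume solution
  -- provides an element.
  · have hne : Nonempty (FVM.trialSpace P r) := ⟨⟨uP, huP.1⟩⟩
    have hK : 0 < (FVM.boundConst r a b * |Λ| + FVM.infSupConst r a b α₀ κ) /
        FVM.infSupConst r a b α₀ κ := div_pos (by linarith) hc
    rw [← div_le_iff₀' hK]
    refine le_ciInf fun v => ?_
    rw [div_le_iff₀' hK]
    exact h.normP_sub_le hab hα₀ hκ hr hα hh hh₀ hM (by linarith) hu2.isPiecewiseH2 huP.1
      (fun w => (hu.aP_eq_pairing hab hα₀ h hr hα hf w).trans (huP.2 w).symm) v.2
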